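/- **Setting.** Let $\mathbb T^p=(\mathbb R/2\pi\mathbb Z)^p$ with Lebesgue measure $dy$, let $\Theta\subseteq\mathbb R^d$ be open and convex, $\theta_0\in\Theta$, and let $m(\cdot;\theta)$, $\theta\in\Theta$, be probability densities on $\mathbb T^p$. Let $Y_1,Y_2,\dots$ be i.i.d. with density $m(\cdot;\theta_0)$; $E_{\theta_0}$ is expectation under this density, and $u(y;\theta)=\nabla_\theta\log m(y;\theta)$ is the score. *Residuals.* Let $s_\theta(y)$ be one of the following: (a) $y\in\mathbb T^p$ itself; (b) the unwrapped datum, i.e. the representative $\hat x_\theta(y)\in\mathbb R^p$ of $y$ in $\prod_r(\mu_r(\theta)-\pi,\mu_r(\theta)+\pi]$, for a location $\mu(\theta)\in\mathbb R^p$; (c) its squared Mahalanobis distance $(\hat x_\theta(y)-\mu(\theta))^\top\Sigma(\theta)^{-1}(\hat x_\theta(y)-\mu(\theta))$, with $\Sigma(\theta)$ positive definite. Let $k$ be a fixed measurable probability density (kernel) on $\mathbb T^p$, $\mathbb R^p$ or $\mathbb R$ respectively, and put $$\hat m_{\vartheta}(y;\theta)=\int k\bigl(s_\theta(y)-s_\theta(t)\bigr)\,m(t;\vartheta)\,dt,\qquad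 \hat f_n(y;\theta)=\frac1n\sum_{i=1}^n k\bigl(s_\theta(y)-s_\theta(Y_i)\bigr),$$ $$\delta_n(y;\theta)=\frac{\hat f_n(y;\theta)}{\hat m_\theta(y;\theta)}-1,\qquad \delta(y;\theta)=\frac{\hat m_{\theta_0}(y;\theta)}{\hat m_\theta(y;\theta)}-1 .$$ *Weights.* Let $a:[-1,\infty)\to\mathbb R$ (the residual adjustment function) be increasing and $C^2$, with $a(0)=0$, $a'(0)=1$ and $a''$ bounded; let $w(\delta)=\min\{1,[a(\delta)+1]^+/(\delta+1)\}$ for $\delta>-1$, and $w(-1)=\lim_{\delta\downarrow-1}w(\delta)$. Put $\Psi=w(\delta)\,u$ and $\Psi_n=w(\delta_n)\,u$, and write $\dot\Psi,\dot\Psi_n$ for the Jacobian matrices with respect to $\theta$. **Assumptions.** 1. (Regularity of the model.) $m(y;\cdot)$ is $C^2$ on $\Theta$ for every $y$; near $\theta_0$ the first and second $\theta$-derivatives of $m(y;\theta)$ are dominated by a Lebesgue integrable function of $y$; $E_{\theta_0}\|u(Y;\theta_0)\|^2<\infty$; near $\theta_0$ the $\theta$-derivative of $u(y;\theta)$ is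 dominated by a function $g(y)$ with $E_{\theta_0}g(Y)<\infty$. 2. The kernel $k$ is of bounded variation (in the sense of Arzelà, i.e. along coordinatewise increasing chains; on a period cell $[0,2\pi]^p$ in case (a)). 3. There is $c>0$ with $m(y;\theta)\ge c$ and $\hat m_\theta(y;\theta)\ge c$ for all $y\in\mathbb T^p$, $\theta\in\Theta$. 4. For all $y$ and $\theta\in\Theta$: $\Psi(y;\cdot)$ is differentiable on $\Theta$, $\dot\Psi(y;\theta)$ is negative definite (i.e. $v^\top\dot\Psi(y;\theta) v<0$ for $v\neq0$; no symmetry is required), and the entries of $\dot\Psi(Y;\theta)$ are integrable under $E_{\theta_0}$. 5. Almost surely, for all $n\ge1$, $y$ and $\theta\in\Theta$: $\Psi_n(y;\cdot)$ is differentiable on $\Theta$ with negative definite $\dot\Psi_n(y;\theta)$; it is twice differentiable, with second derivatives bounded by a finite constant not depending on $n,y,\theta$; and $|\dot\Psi_{n,jk}(y;\theta)|\le K(y)$ for all $j,k$, where $K$ is a fixed function with $E_{\theta_0}K(Y)<\infty$. 6. $\hat\theta_n$ are random vectors such that almost surely, for all sufficiently large $n$, $\hat\theta_n\in\Theta$ and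 $\sum_{i=1}^n\Psi_n(Y_i;\hat\theta_n)=0$. **Theorem (Asymptotic distribution).** Under these assumptions the matrix $A=E_{\theta_0}[\Psi(Y;\theta_0)\Psi(Y;\theta_0)^\top]$ is positive definite; the map $\varepsilon(\theta)=E_{\theta_0}\Psi(Y;\theta)$ is differentiable at $\theta_0$ and $B:=-\bigl(\partial\varepsilon_j/\partial\theta_k\bigr)(\theta_0)$ satisfies Bartlett's identity $A=B$; and $$\sqrt n\,(\hat\theta_n-\theta_0)\xrightarrow{d}N(0,A^{-1}),\qquad A^{-1}=B^{-1}AB^{-\top}.$$ -/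

import Mathlib

open MeasureTheory ProbabilityTheory Filter Topology Matrix

noncomputable section

namespace TorusWLE

instance fact_two_pi_pos : Fact (0 < 2 * Real.pi) := ⟨Real.two_pi_pos⟩

/-- The `p`-torus `(ℝ / 2πℤ)^p`; its measure `volume` is the product of the arc-length measures. -/
abbrev Torus (p : ℕ) : Type := Fin p → AddCircle (2 * Real.pi)

/-- The space that contains the parameter set: `ℝ^d` with the Euclidean norm. -/
abbrev Param (d : ℕ) : Type := EuclideanSpace ℝ (Fin d)

/-- Bounded variation (in the sense of Arzelà) of a function of several real variables on a set `s`: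
the sums of absolute increments along coordinatewise increasing chains in `s` are bounded.
For `p = 1` this is the usual notion, and it is implied by bounded Hardy-Krause variation. -/
def HasBoundedVariation {p : ℕ} (f : (Fin p → ℝ) → ℝ) (s : Set (Fin p → ℝ)) : Prop :=
  ∃ V : ℝ, ∀ (N : ℕ) (x : ℕ → Fin p → ℝ), Monotone x → (∀ i, x i ∈ s) →
    ∑ i ∈ Finset.range N, |f (x (i + 1)) - f (x i)| ≤ V

/-! ### The weight function -/

/-- The function `min {1, [A(δ) + 1]⁺ / (δ + 1)}`, for `δ > -1`. -/
def weightRatio (A : ℝ → ℝ) (δ : ℝ) : ℝ := min 1 (max (A δ + 1) 0 / (δ + 1))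

/-- The weight function on `[-1, ∞)`; at `δ = -1`, where the formula reads `·/0`, it is extended by
its limit from the right. -/
def weight (A : ℝ → ℝ) (δ : ℝ) : ℝ :=
  if δ = -1 then limUnder (𝓝[>] (-1 : ℝ)) (weightRatio A) else weightRatio A δ

/-- The conditions on the residual adjustment function `A`. -/
structure IsRAF (A : ℝ → ℝ) : Prop where
  monotoneOn : MonotoneOn A (Set.Ici (-1))
  contDiffOn : ContDiffOn ℝ 2 A (Set.Ici (-1))
  map_zero : A 0 = 0
  deriv_zero : deriv A 0 = 1
  bounded_second : ∃ C : ℝ, ∀ δ ∈ Set.Ici (-1 : ℝ), |iteratedDerivWithin 2 A (Set.Ici (-1)) δ| ≤ C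

/-! ### Unwrapping and Pearson residuals -/

/-- The unwrapped datum: the representative of `y` in the cell `T(μ) = ∏ᵣ (μᵣ - π, μᵣ + π]`. -/
def unwrap {p : ℕ} (μ : Fin p → ℝ) (y : Torus p) : Fin p → ℝ :=
  fun r => (AddCircle.equivIoc (2 * Real.pi) (μ r - Real.pi) (y r) : ℝ)

/-- The squared Mahalanobis distance `(x - μ)ᵀ Σ⁻¹ (x - μ)`. -/
def sqMahalanobis {p : ℕ} (μ : Fin p → ℝ) (S : Matrix (Fin p) (Fin p) ℝ) (x : Fin p → ℝ) : ℝ :=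
  (x - μ) ⬝ᵥ (S⁻¹ *ᵥ (x - μ))

/-- The three kinds of Pearson residuals, each with its smoothing kernel `k` (of fixed bandwidth):
computed on the torus; computed on the data unwrapped around the location `loc θ`; computed on the
squared Mahalanobis distances, with location `loc θ` and scatter `scat θ`, of the unwrapped data. -/
inductive PearsonKind (p d : ℕ) : Type
  | circular (k : Torus p → ℝ)
  | unwrapped (loc : Param d → Fin p → ℝ) (k : (Fin p → ℝ) → ℝ)
  | mahalanobis (loc : Param d → Fin p → ℝ) (scat : Param d → Matrix (Fin p) (Fin p) ℝ) (k : ℝ → ℝ)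

namespace PearsonKind

variable {p d : ℕ}

/-- The kernel is a density of bounded variation on its space (on a closed period cell for a
kernel on the torus), and the scatter matrices, if any, are positive definite. -/
def IsAdmissible (Θ : Set (Param d)) : PearsonKind p d → Prop
  | circular k => Measurable k ∧ (∀ v, 0 ≤ k v) ∧ ∫ v, k v = 1 ∧
      HasBoundedVariation (fun x : Fin p → ℝ => k (fun r => (x r : AddCircle (2 * Real.pi))))
        (Set.Icc (fun _ => 0) (fun _ => 2 * Real.pi))
  | unwrapped _ k => Measurable k ∧ (∀ v, 0 ≤ k v) ∧ ∫ v, k v = 1 ∧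
      HasBoundedVariation k Set.univ
  | mahalanobis _ scat k => Measurable k ∧ (∀ v, 0 ≤ k v) ∧ ∫ v, k v = 1 ∧
      BoundedVariationOn k Set.univ ∧ ∀ θ ∈ Θ, (scat θ).PosDef

/-- `k(v - s)`, where `v` and `s` are the quantities that represent the torus points `y` and `t` in
the space on which the residuals are computed, at the parameter `θ`. -/
def kernel : PearsonKind p d → Param d → Torus p → Torus p → ℝ
  | circular k, _, y, t => k (y - t)
  | unwrapped loc k, θ, y, t => k (unwrap (loc θ) y - unwrap (loc θ) t)
  | mahalanobis loc scat k, θ, y, t =>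
      k (sqMahalanobis (loc θ) (scat θ) (unwrap (loc θ) y)
        - sqMahalanobis (loc θ) (scat θ) (unwrap (loc θ) t))

/-- The kernel density estimate from the sample `ys 0, …, ys (n - 1)`, at the point represented
by `y`. -/
def kde (R : PearsonKind p d) (ys : ℕ → Torus p) (n : ℕ) (θ : Param d) (y : Torus p) : ℝ :=
  (n : ℝ)⁻¹ * ∑ i ∈ Finset.range n, R.kernel θ y (ys i)

/-- The convolution of the kernel with the law that the density `f` on the torus induces on the
space on which the residuals are computed (`f` itself, the density `f · 1_{T(μ)}` of the unwrapped
datum, or the law of its squared Mahalanobis distance), at the point represented by `y`. -/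
def smoothed (R : PearsonKind p d) (f : Torus p → ℝ) (θ : Param d) (y : Torus p) : ℝ :=
  ∫ t, R.kernel θ y t * f t

/-- The finite sample Pearson residual `δₙ(y; θ)` for the model density `m`. -/
def residualN (R : PearsonKind p d) (m : Torus p → Param d → ℝ) (ys : ℕ → Torus p) (n : ℕ)
    (y : Torus p) (θ : Param d) : ℝ :=
  R.kde ys n θ y / R.smoothed (fun t => m t θ) θ y - 1

/-- The population Pearson residual `δ(y; θ)` at the true density `m(·; θ₀)`. -/
def residual (R : PearsonKind p d) (m : Torus p → Param d → ℝ) (θ₀ : Param d)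
    (y : Torus p) (θ : Param d) : ℝ :=
  R.smoothed (fun t => m t θ₀) θ y / R.smoothed (fun t => m t θ) θ y - 1

end PearsonKind

/-! ### The model and the estimating functions -/

variable {p d : ℕ}

/-- The distribution on the torus with density `m(·; θ)`. -/
def modelLaw (m : Torus p → Param d → ℝ) (θ : Param d) : Measure (Torus p) :=
  volume.withDensity (fun y => ENNReal.ofReal (m y θ))

/-- The score function `∇_θ log m(y; θ)`. -/
def score (m : Torus p → Param d → ℝ) (y : Torus p) (θ : Param d) : Param d :=
  gradient (fun η => Real.log (m y η)) θ

/-- The finite sample estimating function `Ψₙ(y; θ) = w(δₙ(y; θ)) u(y; θ)`. -/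
def psiN (R : PearsonKind p d) (A : ℝ → ℝ) (m : Torus p → Param d → ℝ) (ys : ℕ → Torus p) (n : ℕ)
    (y : Torus p) (θ : Param d) : Param d :=
  weight A (R.residualN m ys n y θ) • score m y θ

/-- The population estimating function `Ψ(y; θ) = w(δ(y; θ)) u(y; θ)`. -/
def psi (R : PearsonKind p d) (A : ℝ → ℝ) (m : Torus p → Param d → ℝ) (θ₀ : Param d)
    (y : Torus p) (θ : Param d) : Param d :=
  weight A (R.residual m θ₀ y θ) • score m y θ

/-- The Jacobian matrix `(∂Fⱼ/∂θₖ)` of `F` at `θ`. -/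
def jacobian (F : Param d → Param d) (θ : Param d) : Matrix (Fin d) (Fin d) ℝ :=
  fun j k => (fderiv ℝ F θ (EuclideanSpace.single k 1)) j

/-- A real square matrix, not necessarily symmetric, whose quadratic form is negative definite. -/
def IsNegDef (M : Matrix (Fin d) (Fin d) ℝ) : Prop :=
  ∀ v : Fin d → ℝ, v ≠ 0 → v ⬝ᵥ (M *ᵥ v) < 0

/-- The matrix `E_{θ₀}[Ψ(Y; θ₀) Ψ(Y; θ₀)ᵀ]`. -/
def psiSecondMoment (R : PearsonKind p d) (A : ℝ → ℝ) (m : Torus p → Param d → ℝ)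
    (θ₀ : Param d) : Matrix (Fin d) (Fin d) ℝ :=
  fun j k => ∫ y, psi R A m θ₀ y θ₀ j * psi R A m θ₀ y θ₀ k ∂(modelLaw m θ₀)

/-- `ε(θ) = E_{θ₀}[Ψ(Y; θ)]`. -/
def meanPsi (R : PearsonKind p d) (A : ℝ → ℝ) (m : Torus p → Param d → ℝ) (θ₀ : Param d)
    (θ : Param d) : Param d :=
  ∫ y, psi R A m θ₀ y θ ∂(modelLaw m θ₀)

/-- The classical regularity conditions for maximum likelihood, at the true value `θ₀`: an open
convex parameter set, densities that are twice continuously differentiable in the parameter,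
with first and second derivatives dominated near `θ₀` by an integrable function, a score with a
finite second moment at `θ₀`, and a derivative of the score dominated near `θ₀` by a function
with finite mean. -/
structure IsRegularModel (m : Torus p → Param d → ℝ) (Θ : Set (Param d)) (θ₀ : Param d) :
    Prop where
  isOpen : IsOpen Θ
  convex : Convex ℝ Θ
  true_mem : θ₀ ∈ Θ
  measurable : ∀ θ ∈ Θ, Measurable fun y => m y θ
  nonneg : ∀ y, ∀ θ ∈ Θ, 0 ≤ m y θ
  integral_eq_one : ∀ θ ∈ Θ, ∫ y, m y θ = 1
  contDiffOn : ∀ y, ContDiffOn ℝ 2 (m y) Θ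
  dominated_density : ∃ U ∈ 𝓝 θ₀, ∃ g : Torus p → ℝ, Integrable g ∧ ∀ y, ∀ θ ∈ U,
    ‖fderiv ℝ (m y) θ‖ ≤ g y ∧ ‖fderiv ℝ (fderiv ℝ (m y)) θ‖ ≤ g y
  score_moment : Integrable (fun y => ‖score m y θ₀‖ ^ 2) (modelLaw m θ₀)
  dominated_score : ∃ U ∈ 𝓝 θ₀, ∃ g : Torus p → ℝ, Integrable g (modelLaw m θ₀) ∧ ∀ y, ∀ θ ∈ U,
    ‖fderiv ℝ (score m y) θ‖ ≤ g y

end TorusWLE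

end

open TorusWLE

namespace TorusWLE
noncomputable section

/-! ### The weight function -/

/-! The weights do not matter to first order. Since `a(δ) = δ + O(δ²)`, the weight satisfies `|w(δ)
- 1| ≤ C δ²` (`IsRAF.exists_abs_weight_sub_one_le`). The population residual compares two densities
smoothed by the same bounded kernel, so it is `O(‖θ - θ₀‖)` uniformly in `y`, and near `θ₀` the
function `Ψ` differs from the score `u` by `O(‖θ - θ₀‖²) ‖u‖` (`exists_norm_psi_sub_score_le`). At
`θ₀` the value and the derivative of `Ψ` are therefore those of `u`: `A` is the Fisher information,
`A = B` is the classical information identity, and `A` is positive definite because it is the mean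
of the positive definite `-Ψ̇` at `θ₀`.

In the sample, the kernel estimate is an average of bounded kernels around the smoothed true
density, so its squared error at an observation has mean `O(1/n)`
(`integral_sq_mean_kernel_mul_le`). The averages of `Ψₙ` and of `u` then differ by `O(1/n + ‖θ -
θ₀‖²)` in mean, which is `o(n^{-1/2})` at `θ₀`. The weight is never differentiated to get at the
Jacobian: the averaged `Ψₙ` has a Lipschitz derivative, so up to `O(t)` its Jacobian is a difference
quotient with step `t ~ n^{-1/2}`. There `Ψₙ` may be replaced by `u` at the cost `O(t + 1/(nt))`,
and the quotients of `u` converge by domination and the law of large numbers (`exists_null_bounds`).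

Negative definiteness on the convex set `Θ` makes the estimating equation monotone, so a root is
close to `θ₀` as soon as the equation is nearly satisfied at `θ₀` (`min_norm_le_of_eq_zero`); no
separate consistency argument is needed. A Taylor expansion gives `L (√n (θ̂ₙ - θ₀)) + Wₙ → 0`,
where `L = -A` and `Wₙ` is the normalized score sum (`tendsto_linearization_zero`). Inverting `L`
and applying the central limit theorem with Slutsky's lemma yields the limit. The Lipschitz constant
is random, so the expansion is carried out path by path along almost surely convergent subsequences.
-/

lemma IsRAF.contDiffAt_zero {A : ℝ → ℝ} (hA : IsRAF A) : ContDiffAt ℝ 2 A 0 :=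
  hA.contDiffOn.contDiffAt (Ici_mem_nhds (by norm_num))

/-- The derivative `A'` is Lipschitz near `0` with `A'(0) = 1`, so `A - id` has slope at most `K
|x|` between `0` and `x`, and the mean value inequality yields the square. -/
lemma IsRAF.exists_abs_sub_le {A : ℝ → ℝ} (hA : IsRAF A) :
    ∃ r > 0, ∃ K, 0 ≤ K ∧ ∀ x, |x| < r → |A x - x| ≤ K * x ^ 2 := by
  have h2 : ContDiffAt ℝ 2 A 0 := hA.contDiffAt_zero
  have h1 : ContDiffAt ℝ 1 (deriv A) 0 := by
    have h := ContDiffAt.fderiv_right (m := 1) (n := 2) h2 (by norm_num)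
    have h' : deriv A = fun x => fderiv ℝ A x 1 := by ext x; simp
    rw [h']
    exact h.clm_apply contDiffAt_const
  obtain ⟨K, t, ht, hK⟩ := h1.exists_lipschitzOnWith
  have hd : ∀ᶠ x in 𝓝 (0 : ℝ), DifferentiableAt ℝ A x := by
    filter_upwards [h2.eventually (by simp)] with x hx using hx.differentiableAt (by norm_num)
  obtain ⟨r, hr, hrt⟩ := Metric.mem_nhds_iff.1 (inter_mem ht hd)
  refine ⟨r, hr, K, K.2, fun x hx => ?_⟩
  have hmem : ∀ y ∈ Metric.closedBall (0 : ℝ) |x|, y ∈ Metric.ball (0 : ℝ) r := fun y hy =>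
    Metric.mem_ball.2 (lt_of_le_of_lt (Metric.mem_closedBall.1 hy) hx)
  have key := (convex_closedBall (0 : ℝ) |x|).norm_image_sub_le_of_norm_hasDerivWithin_le
    (f := fun y => A y - y) (f' := fun y => deriv A y - 1) (C := K * |x|) (x := 0) (y := x)
    (fun y hy => (((hrt (hmem y hy)).2.hasDerivAt).sub (hasDerivAt_id y)).hasDerivWithinAt)
    (fun y hy => by
      have h := hK.dist_le_mul y (hrt (hmem y hy)).1 0 (mem_of_mem_nhds ht)
      rw [hA.deriv_zero, Real.dist_eq, Real.dist_eq, sub_zero] at h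
      refine h.trans (mul_le_mul_of_nonneg_left ?_ K.2)
      simpa using hy)
    (by simp) (by simp)
  simp only [hA.map_zero, sub_zero, Real.norm_eq_abs] at key
  rwa [mul_assoc, abs_mul_abs_self, ← sq] at key

lemma weight_zero {A : ℝ → ℝ} (hA : IsRAF A) : weight A 0 = 1 := by
  simp [weight, weightRatio, hA.map_zero]

lemma weightRatio_nonneg (A : ℝ → ℝ) {δ : ℝ} (h : -1 < δ) : 0 ≤ weightRatio A δ :=
  le_min zero_le_one (div_nonneg (le_max_right _ _) (by linarith))

/-- The weight function is flat to second order at `0`. -/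
lemma IsRAF.exists_abs_weight_sub_one_le {A : ℝ → ℝ} (hA : IsRAF A) :
    ∃ C, 0 ≤ C ∧ ∀ δ, -1 ≤ δ → |weight A δ - 1| ≤ C * δ ^ 2 := by
  obtain ⟨r, hr, K, hK, hAK⟩ := hA.exists_abs_sub_le
  -- The bound `1 / 2` keeps `δ + 1 ≥ 1 / 2`, so dividing the error `K δ²` by `δ + 1` at most
  -- doubles it.
  set s := min r (1 / 2) with hs
  have hs0 : 0 < s := lt_min hr (by norm_num)
  -- One summand for each regime: the point `δ = -1`, where `δ² = 1` and nothing about the limit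
  -- need be known; `|δ| ≥ s`, where `1 ≤ δ² / s²`; and `|δ| < s`, where the expansion of `A`
  -- applies.
  refine ⟨|weight A (-1) - 1| + (1 / s ^ 2 + 2 * K), by positivity, fun δ hδ => ?_⟩
  rcases hδ.eq_or_lt with rfl | hδ
  · have : 0 ≤ 1 / s ^ 2 + 2 * K := by positivity
    linarith
  have hw : weight A δ = weightRatio A δ := by simp [weight, hδ.ne']
  have h0 := weightRatio_nonneg A hδ
  have h1 : weightRatio A δ ≤ 1 := min_le_left _ _
  rw [hw, abs_sub_comm, abs_of_nonneg (by linarith)]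
  suffices h : 1 - weightRatio A δ ≤ (1 / s ^ 2 + 2 * K) * δ ^ 2 by
    have : 0 ≤ |weight A (-1) - 1| * δ ^ 2 := by positivity
    linarith
  rcases lt_or_ge |δ| s with h | h
  · have hA' := hAK δ (h.trans_le (min_le_left _ _))
    have hδ2 : -(1 / 2) < δ := (abs_lt.1 (h.trans_le (min_le_right _ _))).1
    have : 1 - 2 * K * δ ^ 2 ≤ weightRatio A δ := by
      refine le_min (by nlinarith [mul_nonneg hK (sq_nonneg δ)]) ?_
      rw [le_div_iff₀ (by linarith)]
      refine le_trans ?_ (le_max_left _ _)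
      have := (abs_le.1 hA').1
      nlinarith [mul_nonneg hK (sq_nonneg δ)]
    have : 0 ≤ 1 / s ^ 2 * δ ^ 2 := by positivity
    linarith
  · have : 1 ≤ 1 / s ^ 2 * δ ^ 2 := by
      rw [one_div, ← div_eq_inv_mul, le_div_iff₀ (by positivity), one_mul, ← sq_abs δ]
      gcongr
    nlinarith [mul_nonneg hK (sq_nonneg δ)]

/-- Nothing is known about `A` below `-1`, so it is replaced by the continuous function `A (max x
(-1))`, which agrees with it on the range of `f`. -/
lemma IsRAF.measurable_weight_comp {A : ℝ → ℝ} (hA : IsRAF A) {α : Type*} [MeasurableSpace α]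
    {f : α → ℝ} (hf : Measurable f) (h1 : ∀ x, -1 ≤ f x) : Measurable fun x => weight A (f x) := by
  have hc : Continuous fun x : ℝ => A (max x (-1)) :=
    hA.contDiffOn.continuousOn.comp_continuous (by fun_prop) fun x => Set.mem_Ici.2 (le_max_right _ _)
  have he : (fun x => weight A (f x)) = fun x => if f x = -1 then weight A (-1) else
      min 1 (max (A (max (f x) (-1)) + 1) 0 / (f x + 1)) := by
    ext x
    split_ifs with h
    · rw [h]
    · simp [weight, weightRatio, h, max_eq_left (h1 x)]
  rw [he]
  refine Measurable.ite (hf (measurableSet_singleton _)) measurable_const ?_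
  have h := hc.measurable.comp hf
  exact measurable_const.min (((h.add_const 1).max measurable_const).div (hf.add_const 1))

/-! ### Generic tools -/

section Measurability

variable {α E F : Type*} [MeasurableSpace α] [NormedAddCommGroup E] [NormedSpace ℝ E]
  [NormedAddCommGroup F] [NormedSpace ℝ F] [MeasurableSpace F] [BorelSpace F]

/-- The derivative in a fixed direction, at a fixed point, is measurable in a parameter. -/
lemma measurable_fderiv_apply_param [SecondCountableTopology F] {f : α → E → F} {x : E}
    (hf : ∀ᶠ z in 𝓝 x, Measurable fun a => f a z)
    (hd : ∀ a, DifferentiableAt ℝ (f a) x) (v : E) :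
    Measurable fun a => fderiv ℝ (f a) x v := by
  have hlim : Tendsto (fun n : ℕ => x + ((n : ℝ) + 1)⁻¹ • v) atTop (𝓝 x) := by
    have h0 : Tendsto (fun n : ℕ => ((n : ℝ) + 1)⁻¹) atTop (𝓝 0) := by
      simpa using tendsto_one_div_add_atTop_nhds_zero_nat (𝕜 := ℝ)
    simpa using tendsto_const_nhds.add (h0.smul_const v)
  obtain ⟨N, hN⟩ := eventually_atTop.1 (hlim.eventually hf)
  -- The derivative is a limit of difference quotients. The shift by `N` keeps all sampled points in
  -- the neighbourhood where measurability is known.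
  refine measurable_of_tendsto_metrizable
    (f := fun (n : ℕ) a => ((n : ℝ) + N + 1) • (f a (x + ((n : ℝ) + N + 1)⁻¹ • v) - f a x)) ?_ ?_
  · intro n
    have := hN (n + N) (by omega)
    push_cast at this
    exact (this.sub hf.self_of_nhds).const_smul ((n : ℝ) + N + 1)
  · rw [tendsto_pi_nhds]
    intro a
    refine (hd a).hasFDerivAt.lim v (c := fun n : ℕ => (n : ℝ) + N + 1) ?_
    refine tendsto_norm_atTop_atTop.comp ?_
    exact tendsto_atTop_add_const_right _ _
      (tendsto_atTop_add_const_right _ _ tendsto_natCast_atTop_atTop)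

lemma clm_eq_sum_single {d : ℕ} {F : Type*} [NormedAddCommGroup F] [NormedSpace ℝ F]
    (L : EuclideanSpace ℝ (Fin d) →L[ℝ] F) :
    L = ∑ k, (EuclideanSpace.proj k : EuclideanSpace ℝ (Fin d) →L[ℝ] ℝ).smulRight
      (L (EuclideanSpace.single k 1)) := by
  ext v
  have := (EuclideanSpace.basisFun (Fin d) ℝ).sum_repr v
  conv_lhs => rw [← this]
  simp [map_sum]

/-- This reduces estimates for Jacobians in operator norm to the `d` coordinate directions. -/
lemma norm_clm_le_sum_single {d : ℕ} {F : Type*} [NormedAddCommGroup F] [NormedSpace ℝ F]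
    (L : EuclideanSpace ℝ (Fin d) →L[ℝ] F) :
    ‖L‖ ≤ ∑ k, ‖L (EuclideanSpace.single k 1)‖ := by
  refine L.opNorm_le_bound (by positivity) fun v => ?_
  conv_lhs => rw [clm_eq_sum_single L]
  simp only [_root_.sum_apply, ContinuousLinearMap.smulRight_apply, Finset.sum_mul]
  refine norm_sum_le_of_le _ fun k _ => ?_
  rw [norm_smul, mul_comm]
  gcongr
  exact PiLp.norm_apply_le v k

/-- The derivative at a fixed point is measurable in a parameter. -/
lemma stronglyMeasurable_fderiv_param {d : ℕ} [SecondCountableTopology F]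
    {f : α → EuclideanSpace ℝ (Fin d) → F} {x : EuclideanSpace ℝ (Fin d)}
    (hf : ∀ᶠ z in 𝓝 x, Measurable fun a => f a z) (hd : ∀ a, DifferentiableAt ℝ (f a) x) :
    StronglyMeasurable fun a => fderiv ℝ (f a) x := by
  have he : (fun a => fderiv ℝ (f a) x) = fun a => ∑ k,
      (EuclideanSpace.proj k : EuclideanSpace ℝ (Fin d) →L[ℝ] ℝ).smulRight
        (fderiv ℝ (f a) x (EuclideanSpace.single k 1)) := by
    ext1 a; exact clm_eq_sum_single _
  rw [he]
  refine Finset.stronglyMeasurable_fun_sum _ fun k _ => ?_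
  have hc : Continuous fun w : F =>
      (EuclideanSpace.proj k : EuclideanSpace ℝ (Fin d) →L[ℝ] ℝ).smulRight w :=
    (ContinuousLinearMap.smulRightL ℝ (EuclideanSpace ℝ (Fin d)) F
      (EuclideanSpace.proj k)).continuous
  exact hc.comp_stronglyMeasurable
    (measurable_fderiv_apply_param hf hd (EuclideanSpace.single k 1)).stronglyMeasurable

end Measurability

/-- The multivariate central limit theorem. -/
theorem tendstoInDistribution_inv_sqrt_smul_sum {Ω : Type*} [MeasurableSpace Ω] {P : Measure Ω}
    [IsProbabilityMeasure P] {d : ℕ} {X : ℕ → Ω → EuclideanSpace ℝ (Fin d)}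
    (hindep : iIndepFun X P) (hident : ∀ i, IdentDistrib (X i) (X 0) P P)
    (h2 : MemLp (X 0) 2 P) (h0 : ∫ ω, X 0 ω ∂P = 0) {S : Matrix (Fin d) (Fin d) ℝ}
    (hS : S.PosSemidef) (hcov : ∀ j k, ∫ ω, X 0 ω j * X 0 ω k ∂P = S j k) :
    TendstoInDistribution (fun (n : ℕ) ω => (Real.sqrt n)⁻¹ • ∑ i ∈ Finset.range n, X i ω)
      atTop id (fun _ => P) (multivariateGaussian 0 S) where
  forall_aemeasurable n :=
    AEMeasurable.fun_const_smul
      (Finset.aemeasurable_fun_sum _ fun _ _ => (hident _).aemeasurable_fst) _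
  tendsto := by
    refine ProbabilityMeasure.tendsto_iff_tendsto_charFun.2 fun t => ?_
    have hX : ∀ i, AEMeasurable (X i) P := fun i => (hident i).aemeasurable_fst
    have hint : Integrable (X 0) P := h2.integrable (by norm_num)
    have hc : ∀ j, MemLp (fun ω => X 0 ω j) 2 P := fun j =>
      ContinuousLinearMap.comp_memLp' (EuclideanSpace.proj j : EuclideanSpace ℝ (Fin d) →L[ℝ] ℝ) h2
    -- Cramér–Wold: the characteristic function of the vector sum at `t` is that of its projection
    -- on `t` at `1`, to which the one-dimensional theorem applies.
    set Z : ℕ → Ω → ℝ := fun i ω => inner ℝ (X i ω) t with hZ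
    have hg : Measurable fun x : EuclideanSpace ℝ (Fin d) => (inner ℝ x t : ℝ) := by fun_prop
    have hZ0 : MemLp (Z 0) 2 P := h2.inner_const (𝕜 := ℝ) t
    have hmean : ∫ ω, Z 0 ω ∂P = 0 := by
      have := integral_inner (𝕜 := ℝ) hint t
      simp only [h0, inner_zero_right] at this
      rw [← this]
      refine integral_congr_ae (ae_of_all _ fun ω => real_inner_comm _ _)
    have hvar : Var[Z 0; P] = t ⬝ᵥ S *ᵥ t := by
      rw [variance_of_integral_eq_zero hZ0.aemeasurable hmean]
      have he : ∀ ω, Z 0 ω ^ 2 = ∑ j, ∑ k, t j * t k * (X 0 ω j * X 0 ω k) := fun ω => by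
        simp only [hZ, PiLp.inner_apply, sq, Finset.sum_mul_sum]
        refine Finset.sum_congr rfl fun j _ => Finset.sum_congr rfl fun k _ => ?_
        simp; ring
      have hi : ∀ j k, Integrable (fun ω => t j * t k * (X 0 ω j * X 0 ω k)) P := fun j k =>
        ((hc j).integrable_mul (hc k)).const_mul _
      simp only [he]
      rw [integral_finsetSum _ fun j _ => integrable_finsetSum _ fun k _ => hi j k]
      simp only [dotProduct, mulVec, Finset.mul_sum]
      refine Finset.sum_congr rfl fun j _ => ?_
      rw [integral_finsetSum _ fun k _ => hi j k]
      refine Finset.sum_congr rfl fun k _ => ?_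
      rw [integral_const_mul, hcov]; ring
    have hclt := tendstoInDistribution_inv_sqrt_mul_sum_sub (P := P) (X := Z) (Y := id)
      (P' := gaussianReal 0 Var[Z 0; P].toNNReal) ⟨by fun_prop, by simp⟩ hZ0
      (hindep.comp (fun _ x => inner ℝ x t) fun _ => hg) (fun i => (hident i).comp hg)
    have hch := (ProbabilityMeasure.tendsto_iff_tendsto_charFun.1 hclt.tendsto) 1
    have hrhs : charFun ((gaussianReal 0 Var[Z 0; P].toNNReal).map id) 1
        = charFun ((multivariateGaussian 0 S).map id) t := by
      rw [Measure.map_id, Measure.map_id, charFun_gaussianReal, charFun_multivariateGaussian hS,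
        hvar]
      have : 0 ≤ t ⬝ᵥ S *ᵥ t := by rw [← hvar]; exact variance_nonneg _ _
      simp [Real.coe_toNNReal _ this]
    simp only [ProbabilityMeasure.coe_mk, hmean, mul_zero, sub_zero] at hch ⊢
    rw [hrhs] at hch
    refine hch.congr fun n => ?_
    rw [charFun_apply, charFun_apply, integral_map, integral_map]
    · refine integral_congr_ae (ae_of_all _ fun ω => ?_)
      simp only [hZ, inner_smul_left, sum_inner]
      simp
    · exact AEMeasurable.fun_const_smul (Finset.aemeasurable_fun_sum _ fun _ _ => hX _) _
    · fun_prop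
    · exact (Finset.aemeasurable_fun_sum _ fun i _ => hg.comp_aemeasurable (hX i)).const_mul _
    · fun_prop

/-! ### Kernels and Pearson residuals -/

lemma HasBoundedVariation.exists_abs_sub_le {p : ℕ} {f : (Fin p → ℝ) → ℝ} {s : Set (Fin p → ℝ)}
    (hf : HasBoundedVariation f s) :
    ∃ V, ∀ a ∈ s, ∀ b ∈ s, a ≤ b → |f b - f a| ≤ V := by
  obtain ⟨V, hV⟩ := hf
  refine ⟨V, fun a ha b hb hab => ?_⟩
  have h := hV 1 (fun n => if n = 0 then a else b) ?_ ?_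
  · simpa using h
  · refine monotone_nat_of_le_succ fun n => ?_
    rcases n with _ | n <;> simp [hab]
  · intro i
    split_ifs <;> assumption

lemma measurable_unwrap {p : ℕ} (μ : Fin p → ℝ) : Measurable (unwrap μ) := by
  refine measurable_pi_lambda _ fun r => ?_
  exact measurable_subtype_coe.comp
    ((AddCircle.measurableEquivIoc (2 * Real.pi) (μ r - Real.pi)).measurable.comp
      (measurable_pi_apply r))

lemma measurable_sqMahalanobis {p : ℕ} (μ : Fin p → ℝ) (S : Matrix (Fin p) (Fin p) ℝ) :
    Measurable (sqMahalanobis μ S) := by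
  have : Continuous (sqMahalanobis μ S) := by
    unfold sqMahalanobis
    fun_prop
  exact this.measurable

namespace PearsonKind

variable {p d : ℕ} {Θ : Set (Param d)} {R : PearsonKind p d}

lemma IsAdmissible.measurable_kernel (hR : R.IsAdmissible Θ) (θ : Param d) :
    Measurable fun q : Torus p × Torus p => R.kernel θ q.1 q.2 := by
  cases R with
  | circular k => exact hR.1.comp (measurable_fst.sub measurable_snd)
  | unwrapped loc k =>
    exact hR.1.comp (((measurable_unwrap _).comp measurable_fst).sub
      ((measurable_unwrap _).comp measurable_snd))
  | mahalanobis loc scat k =>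
    have h := (measurable_sqMahalanobis (loc θ) (scat θ)).comp (measurable_unwrap (loc θ))
    exact hR.1.comp ((h.comp measurable_fst).sub (h.comp measurable_snd))

lemma IsAdmissible.kernel_nonneg (hR : R.IsAdmissible Θ) (θ : Param d) (y t : Torus p) :
    0 ≤ R.kernel θ y t := by
  cases R with
  | circular k => exact hR.2.1 _
  | unwrapped loc k => exact hR.2.1 _
  | mahalanobis loc scat k => exact hR.2.1 _

/-- Bounded variation enters the argument only through this bound. Chains compare ordered points
only: on the torus the corner `0` lies below every representative in `[0, 2π)`, while in `ℝ^p` an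
arbitrary `x` is joined to `0` through `x ⊓ 0`, which costs `V` twice. The bound is uniform in `θ`
because `θ` affects only the argument of `k`. -/
lemma IsAdmissible.exists_kernel_le (hR : R.IsAdmissible Θ) :
    ∃ M, 0 ≤ M ∧ ∀ θ y t, R.kernel θ y t ≤ M := by
  suffices h : ∃ M, ∀ θ y t, R.kernel θ y t ≤ M by
    obtain ⟨M, hM⟩ := h
    exact ⟨max M 0, le_max_right _ _, fun θ y t => (hM θ y t).trans (le_max_left _ _)⟩
  cases R with
  | circular k =>
    obtain ⟨V, hV⟩ := hR.2.2.2.exists_abs_sub_le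
    refine ⟨k 0 + V, fun θ y t => ?_⟩
    let x : Fin p → ℝ := fun r => (AddCircle.equivIco (2 * Real.pi) 0 ((y - t) r) : ℝ)
    have hx : ∀ r, x r ∈ Set.Ico 0 (0 + 2 * Real.pi) := fun r =>
      (AddCircle.equivIco (2 * Real.pi) 0 ((y - t) r)).2
    have hx' : (fun r => (x r : AddCircle (2 * Real.pi))) = y - t :=
      funext fun r => AddCircle.coe_equivIco
    have h := hV (fun _ => 0) ⟨le_rfl, fun _ => Real.two_pi_pos.le⟩ x
      ⟨fun r => (hx r).1, fun r => by have := (hx r).2.le; simpa using this⟩ fun r => (hx r).1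
    simp only [hx'] at h
    have h0 : (fun r : Fin p => ((0 : ℝ) : AddCircle (2 * Real.pi))) = 0 := by ext r; simp
    rw [h0] at h
    have := (abs_le.1 h).2
    change k (y - t) ≤ _
    linarith
  | unwrapped loc k =>
    obtain ⟨V, hV⟩ := hR.2.2.2.exists_abs_sub_le
    refine ⟨k 0 + V + V, fun θ y t => ?_⟩
    set x := unwrap (loc θ) y - unwrap (loc θ) t with hx
    have h1 := (abs_le.1 (hV (x ⊓ 0) trivial x trivial inf_le_left)).2
    have h2 := (abs_le.1 (hV (x ⊓ 0) trivial 0 trivial inf_le_right)).1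
    change k x ≤ _
    linarith
  | mahalanobis loc scat k =>
    have hb := hR.2.2.2.1
    refine ⟨k 0 + (eVariationOn k Set.univ).toReal, fun θ y t => ?_⟩
    have := hb.sub_le (Set.mem_univ (sqMahalanobis (loc θ) (scat θ) (unwrap (loc θ) y)
        - sqMahalanobis (loc θ) (scat θ) (unwrap (loc θ) t))) (Set.mem_univ 0)
    change k _ ≤ _
    linarith

lemma IsAdmissible.integrable_kernel_mul (hR : R.IsAdmissible Θ) {μ : Measure (Torus p)}
    {f : Torus p → ℝ} (hf : Integrable f μ) (θ : Param d) (y : Torus p) :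
    Integrable (fun t => R.kernel θ y t * f t) μ := by
  obtain ⟨M, hM, hk⟩ := hR.exists_kernel_le
  refine hf.bdd_mul (c := M) ?_ (ae_of_all _ fun t => ?_)
  · exact ((hR.measurable_kernel θ).comp measurable_prodMk_left).aestronglyMeasurable
  · rw [Real.norm_of_nonneg (hR.kernel_nonneg _ _ _)]
    exact hk _ _ _

lemma IsAdmissible.measurable_smoothed (hR : R.IsAdmissible Θ) {f : Torus p → ℝ}
    (hf : Measurable f) (θ : Param d) : Measurable (R.smoothed f θ) := by
  have h : StronglyMeasurable fun q : Torus p × Torus p => R.kernel θ q.1 q.2 * f q.2 :=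
    ((hR.measurable_kernel θ).mul (hf.comp measurable_snd)).stronglyMeasurable
  exact (h.integral_prod_right' (ν := volume)).measurable

lemma IsAdmissible.smoothed_nonneg (hR : R.IsAdmissible Θ) {f : Torus p → ℝ}
    (hf : ∀ t, 0 ≤ f t) (θ : Param d) (y : Torus p) : 0 ≤ R.smoothed f θ y :=
  integral_nonneg fun t => mul_nonneg (hR.kernel_nonneg _ _ _) (hf t)

/-- Both smoothings use the kernel at the same `θ`, so only the `L¹` distance of the densities
matters. This is why no regularity of `θ ↦ R.kernel θ y t` is needed, although unwrapping may jump
with `θ`. -/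
lemma IsAdmissible.abs_smoothed_sub_le (hR : R.IsAdmissible Θ) {M : ℝ}
    (hM : ∀ θ y t, R.kernel θ y t ≤ M) {f g : Torus p → ℝ} (hf : Integrable f) (hg : Integrable g)
    (θ : Param d) (y : Torus p) :
    |R.smoothed f θ y - R.smoothed g θ y| ≤ M * ∫ t, |f t - g t| := by
  unfold smoothed
  rw [← integral_sub (hR.integrable_kernel_mul hf θ y) (hR.integrable_kernel_mul hg θ y),
    ← integral_const_mul]
  refine (norm_integral_le_integral_norm _).trans (integral_mono_of_nonneg
    (ae_of_all _ fun t => norm_nonneg (R.kernel θ y t * f t - R.kernel θ y t * g t)) ((hf.sub hg).abs.const_mul M) (ae_of_all _ fun t => ?_))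
  simp only
  rw [← mul_sub, norm_mul, Real.norm_of_nonneg (hR.kernel_nonneg _ _ _), Real.norm_eq_abs]
  exact mul_le_mul_of_nonneg_right (hM _ _ _) (abs_nonneg _)

lemma IsAdmissible.kde_nonneg (hR : R.IsAdmissible Θ) (ys : ℕ → Torus p) (n : ℕ) (θ : Param d)
    (y : Torus p) : 0 ≤ R.kde ys n θ y :=
  mul_nonneg (by positivity) (Finset.sum_nonneg fun _ _ => hR.kernel_nonneg _ _ _)

end PearsonKind

/-! ### The model -/

section Model

variable {p d : ℕ} {m : Torus p → Param d → ℝ} {Θ : Set (Param d)} {θ₀ : Param d}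

lemma inner_score (m : Torus p → Param d → ℝ) (y : Torus p) (θ v : Param d) :
    inner ℝ (score m y θ) v = fderiv ℝ (fun η => Real.log (m y η)) θ v := by
  simp [score, gradient]

lemma score_apply (m : Torus p → Param d → ℝ) (y : Torus p) (θ : Param d) (k : Fin d) :
    score m y θ k = fderiv ℝ (fun η => Real.log (m y η)) θ (EuclideanSpace.single k 1) := by
  rw [← inner_score]
  simp [EuclideanSpace.inner_single_right]

namespace IsRegularModel

variable (hm : IsRegularModel m Θ θ₀)
include hm

lemma mem_nhds {θ : Param d} (hθ : θ ∈ Θ) : Θ ∈ 𝓝 θ := hm.isOpen.mem_nhds hθ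

lemma contDiffAt (y : Torus p) {θ : Param d} (hθ : θ ∈ Θ) : ContDiffAt ℝ 2 (m y) θ :=
  (hm.contDiffOn y).contDiffAt (hm.mem_nhds hθ)

lemma differentiableAt (y : Torus p) {θ : Param d} (hθ : θ ∈ Θ) : DifferentiableAt ℝ (m y) θ :=
  (hm.contDiffAt y hθ).differentiableAt (by norm_num)

lemma differentiableAt_fderiv (y : Torus p) {θ : Param d} (hθ : θ ∈ Θ) :
    DifferentiableAt ℝ (fderiv ℝ (m y)) θ :=
  ((hm.contDiffAt y hθ).fderiv_right (m := 1) (by norm_num)).differentiableAt (by norm_num)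

lemma integrable {θ : Param d} (hθ : θ ∈ Θ) : Integrable fun y => m y θ := by
  by_contra h
  have := hm.integral_eq_one θ hθ
  rw [integral_undef h] at this
  exact zero_ne_one this

lemma isProbabilityMeasure : IsProbabilityMeasure (modelLaw m θ₀) := by
  constructor
  rw [modelLaw, withDensity_apply _ MeasurableSet.univ, Measure.restrict_univ,
    ← ofReal_integral_eq_lintegral_ofReal (hm.integrable hm.true_mem)
      (ae_of_all _ fun y => hm.nonneg y _ hm.true_mem), hm.integral_eq_one _ hm.true_mem,
    ENNReal.ofReal_one]

lemma integral_modelLaw {E : Type*} [NormedAddCommGroup E] [NormedSpace ℝ E] (f : Torus p → E) :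
    ∫ y, f y ∂(modelLaw m θ₀) = ∫ y, m y θ₀ • f y := by
  rw [modelLaw, integral_withDensity_eq_integral_toReal_smul
    (hm.measurable _ hm.true_mem).ennreal_ofReal (ae_of_all _ fun _ => ENNReal.ofReal_lt_top)]
  simp [ENNReal.toReal_ofReal, hm.nonneg _ _ hm.true_mem]

lemma integrable_modelLaw_iff {E : Type*} [NormedAddCommGroup E] [NormedSpace ℝ E]
    {f : Torus p → E} :
    Integrable f (modelLaw m θ₀) ↔ Integrable fun y => m y θ₀ • f y := by
  rw [modelLaw, integrable_withDensity_iff_integrable_smul'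
    (hm.measurable _ hm.true_mem).ennreal_ofReal (ae_of_all _ fun _ => ENNReal.ofReal_lt_top)]
  simp [ENNReal.toReal_ofReal, hm.nonneg _ _ hm.true_mem]

lemma stronglyMeasurable_fderiv {θ : Param d} (hθ : θ ∈ Θ) :
    StronglyMeasurable fun y => fderiv ℝ (m y) θ :=
  stronglyMeasurable_fderiv_param (by
    filter_upwards [hm.mem_nhds hθ] with z hz using hm.measurable z hz)
    fun y => hm.differentiableAt y hθ

lemma hasFDerivAt_fderiv_apply (y : Torus p) {θ : Param d} (hθ : θ ∈ Θ) (v : Param d) :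
    HasFDerivAt (fun η => fderiv ℝ (m y) η v)
      ((ContinuousLinearMap.apply ℝ ℝ v).comp (fderiv ℝ (fderiv ℝ (m y)) θ)) θ :=
  (ContinuousLinearMap.apply ℝ ℝ v).hasFDerivAt.comp θ (hm.differentiableAt_fderiv y hθ).hasFDerivAt

/-- The mean derivative of the density vanishes near the true value. -/
lemma eventually_integral_fderiv_eq_zero :
    ∀ᶠ θ in 𝓝 θ₀, ∫ y, fderiv ℝ (m y) θ = 0 := by
  obtain ⟨U, hU, g, hg, hUg⟩ := hm.dominated_density
  filter_upwards [eventually_mem_nhds_iff.2 hU, eventually_mem_nhds_iff.2 (hm.mem_nhds hm.true_mem)]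
    with θ hθ hθ'
  have h := hasFDerivAt_integral_of_dominated_of_fderiv_le (μ := (volume : Measure (Torus p)))
    (𝕜 := ℝ) (F := fun θ y => m y θ) (F' := fun θ y => fderiv ℝ (m y) θ) (inter_mem hθ hθ')
    (by filter_upwards [hθ'] with z hz using (hm.measurable z hz).aestronglyMeasurable)
    (hm.integrable (mem_of_mem_nhds hθ'))
    (hm.stronglyMeasurable_fderiv (mem_of_mem_nhds hθ')).aestronglyMeasurable
    (ae_of_all _ fun y z hz => (hUg y z hz.1).1) hg
    (ae_of_all _ fun y z hz => (hm.differentiableAt y hz.2).hasFDerivAt)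
  have h' : HasFDerivAt (fun θ => ∫ y, m y θ) (0 : Param d →L[ℝ] ℝ) θ :=
    (hasFDerivAt_const (1 : ℝ) θ).congr_of_eventuallyEq (by
      filter_upwards [hθ'] with z hz using hm.integral_eq_one z hz)
  exact h.unique h'

/-- The mean second derivative of the density vanishes at the true value. -/
lemma integral_fderiv_fderiv_apply_eq_zero (w v : Param d) :
    Integrable (fun y => fderiv ℝ (fderiv ℝ (m y)) θ₀ w v) ∧
      ∫ y, fderiv ℝ (fderiv ℝ (m y)) θ₀ w v = 0 := by
  obtain ⟨U, hU, g, hg, hUg⟩ := hm.dominated_density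
  have hΘ := hm.mem_nhds hm.true_mem
  have hmeas' : ∀ z ∈ Θ, Measurable fun y => fderiv ℝ (m y) z v := fun z hz =>
    measurable_fderiv_apply_param (by
      filter_upwards [hm.mem_nhds hz] with x hx using hm.measurable x hx)
      (fun y => hm.differentiableAt y hz) v
  -- With `v` fixed, the second derivative is the derivative of a real-valued function, to which
  -- parametric measurability applies.
  have hmeas : StronglyMeasurable fun y =>
      (ContinuousLinearMap.apply ℝ ℝ v).comp (fderiv ℝ (fderiv ℝ (m y)) θ₀) := by
    have := stronglyMeasurable_fderiv_param (f := fun y η => fderiv ℝ (m y) η v) (x := θ₀)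
      (by filter_upwards [hΘ] with z hz using hmeas' z hz)
      fun y => (hm.hasFDerivAt_fderiv_apply y hm.true_mem v).differentiableAt
    simpa only [(hm.hasFDerivAt_fderiv_apply _ hm.true_mem v).fderiv] using this
  have hbd : ∀ y, ∀ z ∈ U, ‖(ContinuousLinearMap.apply ℝ ℝ v).comp (fderiv ℝ (fderiv ℝ (m y)) z)‖
      ≤ ‖v‖ * g y := fun y z hz => by
    refine ContinuousLinearMap.opNorm_le_bound _
      (mul_nonneg (norm_nonneg _) ((norm_nonneg _).trans (hUg y z hz).1)) fun x => ?_
    have h1 := (fderiv ℝ (fderiv ℝ (m y)) z).le_opNorm x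
    have h2 := (fderiv ℝ (fderiv ℝ (m y)) z x).le_opNorm v
    have h3 := (hUg y z hz).2
    simp only [ContinuousLinearMap.comp_apply, ContinuousLinearMap.apply_apply]
    calc _ ≤ _ := h2
      _ ≤ g y * ‖x‖ * ‖v‖ := by
        gcongr
        exact h1.trans (by gcongr)
      _ = _ := by ring
  have h := hasFDerivAt_integral_of_dominated_of_fderiv_le (μ := (volume : Measure (Torus p)))
    (𝕜 := ℝ) (F := fun θ y => fderiv ℝ (m y) θ v)
    (F' := fun θ y => (ContinuousLinearMap.apply ℝ ℝ v).comp (fderiv ℝ (fderiv ℝ (m y)) θ))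
    (inter_mem hU hΘ)
    (by filter_upwards [hΘ] with z hz using (hmeas' z hz).aestronglyMeasurable)
    ((hg.mul_const ‖v‖).mono' (hmeas' _ hm.true_mem).aestronglyMeasurable
      (ae_of_all _ fun y => (fderiv ℝ (m y) θ₀).le_of_opNorm_le (hUg y _ (mem_of_mem_nhds hU)).1 v))
    hmeas.aestronglyMeasurable
    (ae_of_all _ fun y z hz => hbd y z hz.1) (hg.const_mul _)
    (ae_of_all _ fun y z hz => hm.hasFDerivAt_fderiv_apply y hz.2 v)
  have hint : Integrable fun y =>
      (ContinuousLinearMap.apply ℝ ℝ v).comp (fderiv ℝ (fderiv ℝ (m y)) θ₀) :=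
    (hg.const_mul _).mono' hmeas.aestronglyMeasurable
      (ae_of_all _ fun y => hbd y _ (mem_of_mem_nhds hU))
  refine ⟨hint.apply_continuousLinearMap w, ?_⟩
  have hz : ∀ᶠ θ in 𝓝 θ₀, ∫ y, fderiv ℝ (m y) θ v = 0 := by
    filter_upwards [hm.eventually_integral_fderiv_eq_zero, hΘ, hU] with z hz hz' hzU
    have hi : Integrable fun y => fderiv ℝ (m y) z :=
      hg.mono' (hm.stronglyMeasurable_fderiv hz').aestronglyMeasurable
        (ae_of_all _ fun y => (hUg y _ hzU).1)
    rw [← ContinuousLinearMap.integral_apply hi, hz]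
    rfl
  have h0 := h.unique ((hasFDerivAt_const (0 : ℝ) θ₀).congr_of_eventuallyEq hz)
  have := DFunLike.congr_fun h0 w
  rw [ContinuousLinearMap.integral_apply hint] at this
  exact this

lemma integral_fderiv_apply_eq_zero (v : Param d) : ∫ y, fderiv ℝ (m y) θ₀ v = 0 := by
  obtain ⟨U, hU, g, hg, hUg⟩ := hm.dominated_density
  have hi : Integrable fun y => fderiv ℝ (m y) θ₀ :=
    hg.mono' (hm.stronglyMeasurable_fderiv hm.true_mem).aestronglyMeasurable
      (ae_of_all _ fun y => (hUg y _ (mem_of_mem_nhds hU)).1)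
  rw [← ContinuousLinearMap.integral_apply hi, hm.eventually_integral_fderiv_eq_zero.self_of_nhds]
  rfl

variable (hpos : ∀ y, ∀ θ ∈ Θ, 0 < m y θ)
include hpos

lemma fderiv_log (y : Torus p) {θ : Param d} (hθ : θ ∈ Θ) :
    fderiv ℝ (fun η => Real.log (m y η)) θ = (m y θ)⁻¹ • fderiv ℝ (m y) θ :=
  ((hm.differentiableAt y hθ).hasFDerivAt.log (hpos y θ hθ).ne').fderiv

lemma smul_score_apply (y : Torus p) {θ : Param d} (hθ : θ ∈ Θ) (k : Fin d) :
    m y θ * score m y θ k = fderiv ℝ (m y) θ (EuclideanSpace.single k 1) := by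
  rw [score_apply, hm.fderiv_log hpos y hθ]
  simp [mul_inv_cancel_left₀ (hpos y θ hθ).ne']

lemma differentiableAt_score (y : Torus p) {θ : Param d} (hθ : θ ∈ Θ) :
    DifferentiableAt ℝ (score m y) θ := by
  have h : ContDiffAt ℝ 2 (fun η => Real.log (m y η)) θ :=
    (hm.contDiffAt y hθ).log (hpos y θ hθ).ne'
  have h' : DifferentiableAt ℝ (fderiv ℝ fun η => Real.log (m y η)) θ :=
    (h.fderiv_right (m := 1) (by norm_num)).differentiableAt (by norm_num)
  exact ((InnerProductSpace.toDual ℝ (Param d)).symm.toContinuousLinearEquiv.differentiableAt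
    (x := fderiv ℝ (fun η => Real.log (m y η)) θ)).comp θ h'

lemma measurable_score {θ : Param d} (hθ : θ ∈ Θ) : Measurable fun y => score m y θ := by
  have h : StronglyMeasurable fun y => fderiv ℝ (fun η => Real.log (m y η)) θ :=
    stronglyMeasurable_fderiv_param (by
      filter_upwards [hm.mem_nhds hθ] with z hz using (hm.measurable z hz).log)
      fun y => (hm.differentiableAt y hθ).log (hpos y θ hθ).ne'
  exact ((InnerProductSpace.toDual ℝ (Param d)).symm.continuous.comp_stronglyMeasurable h).measurable

/-- The derivative of the score at the true value. -/
lemma mul_fderiv_score (y : Torus p) {θ : Param d} (hθ : θ ∈ Θ) (j k : Fin d) :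
    m y θ * fderiv ℝ (score m y) θ (EuclideanSpace.single k 1) j =
      fderiv ℝ (fderiv ℝ (m y)) θ (EuclideanSpace.single k 1) (EuclideanSpace.single j 1)
        - m y θ * (score m y θ j * score m y θ k) := by
  set ej : Param d := EuclideanSpace.single j 1 with hej
  set ek : Param d := EuclideanSpace.single k 1 with hek
  -- The function `m uⱼ = ∂ⱼ m` is differentiated twice, by the product rule and directly, and the
  -- results are compared.
  have h1 : HasFDerivAt (fun η => m y η * score m y η j)
      (m y θ • (EuclideanSpace.proj j : Param d →L[ℝ] ℝ).comp (fderiv ℝ (score m y) θ)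
        + score m y θ j • fderiv ℝ (m y) θ) θ :=
    (hm.differentiableAt y hθ).hasFDerivAt.mul
      ((EuclideanSpace.proj j : Param d →L[ℝ] ℝ).hasFDerivAt.comp θ
        (hm.differentiableAt_score hpos y hθ).hasFDerivAt)
  have h2 : HasFDerivAt (fun η => m y η * score m y η j)
      ((ContinuousLinearMap.apply ℝ ℝ ej).comp (fderiv ℝ (fderiv ℝ (m y)) θ)) θ := by
    refine (hm.hasFDerivAt_fderiv_apply y hθ ej).congr_of_eventuallyEq ?_
    filter_upwards [hm.mem_nhds hθ] with z hz
    simpa using hm.smul_score_apply hpos y hz j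
  have h := DFunLike.congr_fun (h1.unique h2) ek
  simp only [_root_.add_apply, _root_.smul_apply, smul_eq_mul,
    ContinuousLinearMap.comp_apply, ContinuousLinearMap.apply_apply,
    PiLp.proj_apply, hek, ← hm.smul_score_apply hpos y hθ k] at h
  rw [hek, ← h]
  ring

lemma memLp_score : MemLp (fun y => score m y θ₀) 2 (modelLaw m θ₀) := by
  rw [memLp_two_iff_integrable_sq_norm (hm.measurable_score hpos hm.true_mem).aestronglyMeasurable]
  exact hm.score_moment

lemma integrable_score : Integrable (fun y => score m y θ₀) (modelLaw m θ₀) := by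
  have := hm.isProbabilityMeasure
  exact (hm.memLp_score hpos).integrable (by norm_num)

lemma memLp_score_apply (j : Fin d) : MemLp (fun y => score m y θ₀ j) 2 (modelLaw m θ₀) :=
  ContinuousLinearMap.comp_memLp' (EuclideanSpace.proj j : Param d →L[ℝ] ℝ) (hm.memLp_score hpos)

lemma integral_score_eq_zero : ∫ y, score m y θ₀ ∂(modelLaw m θ₀) = 0 := by
  ext j
  have h := (EuclideanSpace.proj j : Param d →L[ℝ] ℝ).integral_comp_comm (hm.integrable_score hpos)
  simp only [PiLp.proj_apply] at h
  rw [← h, hm.integral_modelLaw]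
  simp only [smul_eq_mul, hm.smul_score_apply hpos _ hm.true_mem]
  exact hm.integral_fderiv_apply_eq_zero _

/-- The information identity: `m ∂ₖuⱼ = ∂ₖ∂ⱼm - m uⱼuₖ`, and the second derivatives of a family of
densities integrate to zero. -/
lemma integral_fderiv_score (j k : Fin d) :
    ∫ y, fderiv ℝ (score m y) θ₀ (EuclideanSpace.single k 1) j ∂(modelLaw m θ₀) =
      -∫ y, score m y θ₀ j * score m y θ₀ k ∂(modelLaw m θ₀) := by
  have hi : Integrable (fun y => score m y θ₀ j * score m y θ₀ k) (modelLaw m θ₀) :=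
    (hm.memLp_score_apply hpos j).integrable_mul (hm.memLp_score_apply hpos k)
  obtain ⟨h1, h2⟩ := hm.integral_fderiv_fderiv_apply_eq_zero (EuclideanSpace.single k 1)
    (EuclideanSpace.single j 1)
  rw [hm.integral_modelLaw, hm.integral_modelLaw]
  have hi' := hm.integrable_modelLaw_iff.1 hi
  simp only [smul_eq_mul] at hi'
  simp only [smul_eq_mul, hm.mul_fderiv_score hpos _ hm.true_mem]
  rw [integral_sub h1 hi', h2, zero_sub]

/-- Local Lipschitz bounds, with integrable constants, for the density and the score. -/
lemma exists_local_bounds : ∃ r > 0, Metric.ball θ₀ r ⊆ Θ ∧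
    (∃ g : Torus p → ℝ, Integrable g ∧ ∀ y, ∀ θ ∈ Metric.ball θ₀ r,
      |m y θ - m y θ₀| ≤ g y * ‖θ - θ₀‖) ∧
    ∃ g : Torus p → ℝ, Integrable g (modelLaw m θ₀) ∧ (∀ y, 0 ≤ g y) ∧
      (∀ y, ‖fderiv ℝ (score m y) θ₀‖ ≤ g y) ∧
      ∀ y, ∀ θ ∈ Metric.ball θ₀ r, ‖score m y θ - score m y θ₀‖ ≤ g y * ‖θ - θ₀‖ := by
  obtain ⟨U, hU, g, hg, hUg⟩ := hm.dominated_density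
  obtain ⟨U', hU', g', hg', hUg'⟩ := hm.dominated_score
  obtain ⟨r, hr, hrU⟩ := Metric.mem_nhds_iff.1
    (inter_mem (inter_mem hU hU') (hm.mem_nhds hm.true_mem))
  have h0 : θ₀ ∈ Metric.ball θ₀ r := Metric.mem_ball_self hr
  refine ⟨r, hr, fun z hz => (hrU hz).2, ⟨g, hg, fun y θ hθ => ?_⟩, g', hg',
    fun y => (norm_nonneg _).trans (hUg' y _ (hrU h0).1.2), fun y => hUg' y _ (hrU h0).1.2,
    fun y θ hθ => ?_⟩
  · exact (convex_ball θ₀ r).norm_image_sub_le_of_norm_fderiv_le (𝕜 := ℝ)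
      (fun z hz => hm.differentiableAt y (hrU hz).2) (fun z hz => (hUg y z (hrU hz).1.1).1) h0 hθ
  · exact (convex_ball θ₀ r).norm_image_sub_le_of_norm_fderiv_le (𝕜 := ℝ)
      (fun z hz => hm.differentiableAt_score hpos y (hrU hz).2)
      (fun z hz => hUg' y z (hrU hz).1.2) h0 hθ

end IsRegularModel

end Model

/-! ### The population estimating function -/

section Population

variable {p d : ℕ} {m : Torus p → Param d → ℝ} {Θ : Set (Param d)} {θ₀ : Param d}
  {R : PearsonKind p d} {A : ℝ → ℝ} {c : ℝ}

lemma residual_self (y : Torus p) (h : 0 < R.smoothed (fun t => m t θ₀) θ₀ y) :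
    R.residual m θ₀ y θ₀ = 0 := by
  rw [PearsonKind.residual, div_self h.ne', sub_self]

lemma psi_self (hA : IsRAF A) (y : Torus p) (h : 0 < R.smoothed (fun t => m t θ₀) θ₀ y) :
    psi R A m θ₀ y θ₀ = score m y θ₀ := by
  rw [psi, residual_self y h, weight_zero hA, one_smul]

lemma neg_one_le_residual (hm : IsRegularModel m Θ θ₀) (hR : R.IsAdmissible Θ) {θ : Param d}
    (y : Torus p) (h : 0 < R.smoothed (fun t => m t θ) θ y) : -1 ≤ R.residual m θ₀ y θ := by
  have : 0 ≤ R.smoothed (fun t => m t θ₀) θ y / R.smoothed (fun t => m t θ) θ y :=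
    div_nonneg (hR.smoothed_nonneg (fun t => hm.nonneg t _ hm.true_mem) _ _) h.le
  rw [PearsonKind.residual]
  linarith

lemma neg_one_le_residualN (hR : R.IsAdmissible Θ) {θ : Param d} (ys : ℕ → Torus p) (n : ℕ)
    (y : Torus p) (h : 0 < R.smoothed (fun t => m t θ) θ y) : -1 ≤ R.residualN m ys n y θ := by
  have : 0 ≤ R.kde ys n θ y / R.smoothed (fun t => m t θ) θ y :=
    div_nonneg (hR.kde_nonneg _ _ _ _) h.le
  rw [PearsonKind.residualN]
  linarith

/-- Near `θ₀` the smoothed true and model densities differ by `O(‖θ - θ₀‖)`, uniformly. -/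
lemma exists_abs_smoothed_sub_le (hm : IsRegularModel m Θ θ₀) (hR : R.IsAdmissible Θ)
    (hpos : ∀ y, ∀ θ ∈ Θ, 0 < m y θ) :
    ∃ r > 0, ∃ K, 0 ≤ K ∧ Metric.ball θ₀ r ⊆ Θ ∧ ∀ y, ∀ θ ∈ Metric.ball θ₀ r,
      |R.smoothed (fun t => m t θ₀) θ y - R.smoothed (fun t => m t θ) θ y| ≤ K * ‖θ - θ₀‖ := by
  obtain ⟨r, hr, hrΘ, ⟨g, hg, hgb⟩, -⟩ := hm.exists_local_bounds hpos
  obtain ⟨M, hM, hk⟩ := hR.exists_kernel_le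
  refine ⟨r, hr, M * ∫ y, |g y|, mul_nonneg hM (integral_nonneg fun _ => abs_nonneg _), hrΘ,
    fun y θ hθ => ?_⟩
  refine (hR.abs_smoothed_sub_le hk (hm.integrable hm.true_mem) (hm.integrable (hrΘ hθ))
    θ y).trans ?_
  rw [mul_assoc, ← integral_mul_const]
  gcongr
  · exact ((hm.integrable hm.true_mem).sub (hm.integrable (hrΘ hθ))).abs
  · exact hg.abs.mul_const _
  · intro t
    simp only
    rw [abs_sub_comm]
    exact (hgb t θ hθ).trans (by gcongr; exact le_abs_self _)

lemma abs_residual_le {θ : Param d} {y : Torus p} {K : ℝ} (hc : 0 < c)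
    (hs : c ≤ R.smoothed (fun t => m t θ) θ y)
    (h : |R.smoothed (fun t => m t θ₀) θ y - R.smoothed (fun t => m t θ) θ y| ≤ K * ‖θ - θ₀‖) :
    |R.residual m θ₀ y θ| ≤ K / c * ‖θ - θ₀‖ := by
  have hs0 := hc.trans_le hs
  rw [PearsonKind.residual, div_sub_one hs0.ne', abs_div, abs_of_pos hs0, div_le_iff₀ hs0]
  refine h.trans ?_
  have h0 := (abs_nonneg _).trans h
  calc K * ‖θ - θ₀‖ = K * ‖θ - θ₀‖ / c * c := by field_simp
    _ ≤ K * ‖θ - θ₀‖ / c * R.smoothed (fun t => m t θ) θ y := by gcongr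
    _ = _ := by ring

lemma measurable_psi (hm : IsRegularModel m Θ θ₀) (hR : R.IsAdmissible Θ) (hA : IsRAF A)
    (hpos : ∀ y, ∀ θ ∈ Θ, 0 < m y θ)
    (hs : ∀ y, ∀ θ ∈ Θ, 0 < R.smoothed (fun t => m t θ) θ y) {θ : Param d} (hθ : θ ∈ Θ) :
    Measurable fun y => psi R A m θ₀ y θ := by
  refine Measurable.smul (hA.measurable_weight_comp ?_ fun y =>
    neg_one_le_residual hm hR y (hs y θ hθ)) (hm.measurable_score hpos hθ)
  exact ((hR.measurable_smoothed (hm.measurable _ hm.true_mem) θ).div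
    (hR.measurable_smoothed (hm.measurable _ hθ) θ)).sub_const 1

/-- `Ψ(y; ·)` and the score agree to second order at `θ₀`, uniformly in `y`. -/
lemma exists_norm_psi_sub_score_le (hm : IsRegularModel m Θ θ₀) (hR : R.IsAdmissible Θ)
    (hA : IsRAF A) (hc : 0 < c)
    (hlow : ∀ y, ∀ θ ∈ Θ, c ≤ m y θ ∧ c ≤ R.smoothed (fun t => m t θ) θ y) :
    ∃ r > 0, ∃ K, 0 ≤ K ∧ Metric.ball θ₀ r ⊆ Θ ∧ ∀ y, ∀ θ ∈ Metric.ball θ₀ r,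
      ‖psi R A m θ₀ y θ - score m y θ‖ ≤ K * ‖θ - θ₀‖ ^ 2 * ‖score m y θ‖ := by
  obtain ⟨r, hr, K, hK, hrΘ, hb⟩ := exists_abs_smoothed_sub_le (R := R) hm hR
    fun y θ hθ => hc.trans_le (hlow y θ hθ).1
  obtain ⟨C, hC, hw⟩ := hA.exists_abs_weight_sub_one_le
  refine ⟨r, hr, C * (K / c) ^ 2, by positivity, hrΘ, fun y θ hθ => ?_⟩
  have h1 := abs_residual_le hc (hlow y θ (hrΘ hθ)).2 (hb y θ hθ)
  have h2 := hw _ (neg_one_le_residual hm hR y (hc.trans_le (hlow y θ (hrΘ hθ)).2))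
  have h3 : psi R A m θ₀ y θ - score m y θ =
      (weight A (R.residual m θ₀ y θ) - 1) • score m y θ := by
    rw [psi, sub_smul, one_smul]
  rw [h3, norm_smul, Real.norm_eq_abs]
  gcongr
  refine h2.trans ?_
  rw [mul_assoc, ← mul_pow, ← sq_abs]
  gcongr

/-- The difference `Ψ - u` is `O(‖θ - θ₀‖²)` and so has derivative zero at `θ₀`. Neither the weight
nor the residual is differentiated. -/
lemma hasFDerivAt_psi (hm : IsRegularModel m Θ θ₀) (hR : R.IsAdmissible Θ)
    (hA : IsRAF A) (hc : 0 < c)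
    (hlow : ∀ y, ∀ θ ∈ Θ, c ≤ m y θ ∧ c ≤ R.smoothed (fun t => m t θ) θ y) (y : Torus p) :
    HasFDerivAt (psi R A m θ₀ y) (fderiv ℝ (score m y) θ₀) θ₀ := by
  obtain ⟨r, hr, K, hK, hrΘ, hb⟩ := exists_norm_psi_sub_score_le hm hR hA hc hlow
  have hu := hm.differentiableAt_score (fun y θ hθ => hc.trans_le (hlow y θ hθ).1) y hm.true_mem
  have hO : (fun θ => psi R A m θ₀ y θ - score m y θ) =O[𝓝 θ₀] fun θ => ‖θ - θ₀‖ ^ 2 := by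
    have h1 : (fun θ => psi R A m θ₀ y θ - score m y θ) =O[𝓝 θ₀]
        fun θ => ‖θ - θ₀‖ ^ 2 * ‖score m y θ‖ := by
      refine Asymptotics.IsBigO.of_bound K ?_
      filter_upwards [Metric.ball_mem_nhds θ₀ hr] with θ hθ
      rw [norm_mul, norm_norm, norm_pow, norm_norm, ← mul_assoc]
      exact hb y θ hθ
    have h2 : (fun θ => ‖score m y θ‖) =O[𝓝 θ₀] fun _ => (1 : ℝ) :=
      hu.continuousAt.norm.isBigO_one ℝ
    simpa using h1.trans ((Asymptotics.isBigO_refl _ _).mul h2)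
  have := (hO.hasFDerivAt one_lt_two).add hu.hasFDerivAt
  rw [zero_add] at this
  refine this.congr_of_eventuallyEq (Eventually.of_forall fun θ => ?_)
  simp

/-- The mean of `Ψ` is differentiable at `θ₀`, with the mean derivative of the score as its
derivative. -/
lemma hasFDerivAt_meanPsi (hm : IsRegularModel m Θ θ₀) (hR : R.IsAdmissible Θ)
    (hA : IsRAF A) (hc : 0 < c)
    (hlow : ∀ y, ∀ θ ∈ Θ, c ≤ m y θ ∧ c ≤ R.smoothed (fun t => m t θ) θ y) :
    Integrable (fun y => fderiv ℝ (score m y) θ₀) (modelLaw m θ₀) ∧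
    HasFDerivAt (meanPsi R A m θ₀) (∫ y, fderiv ℝ (score m y) θ₀ ∂(modelLaw m θ₀)) θ₀ := by
  have hpos : ∀ y, ∀ θ ∈ Θ, 0 < m y θ := fun y θ hθ => hc.trans_le (hlow y θ hθ).1
  have hs : ∀ y, ∀ θ ∈ Θ, 0 < R.smoothed (fun t => m t θ) θ y :=
    fun y θ hθ => hc.trans_le (hlow y θ hθ).2
  have hΘ := hm.mem_nhds hm.true_mem
  obtain ⟨r, hr, K, hK, hrΘ, hb⟩ := exists_norm_psi_sub_score_le hm hR hA hc hlow
  obtain ⟨r', hr', -, -, g, hg, hg0, -, hgb⟩ := hm.exists_local_bounds hpos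
  -- Inside the unit ball `‖θ - θ₀‖² ≤ ‖θ - θ₀‖`, which turns the quadratic remainder into a
  -- Lipschitz bound.
  have hball : Metric.ball θ₀ r ∩ Metric.ball θ₀ r' ∩ Metric.ball θ₀ 1 ∈ 𝓝 θ₀ :=
    inter_mem (inter_mem (Metric.ball_mem_nhds _ hr) (Metric.ball_mem_nhds _ hr'))
      (Metric.ball_mem_nhds _ one_pos)
  -- This form of differentiation under the integral asks for a Lipschitz estimate based at `θ₀` and
  -- a derivative at `θ₀` alone, so `Ψ̇` need not be dominated at nearby points.
  refine hasFDerivAt_integral_of_dominated_loc_of_lip' (𝕜 := ℝ)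
    (F := fun θ y => psi R A m θ₀ y θ) (F' := fun y => fderiv ℝ (score m y) θ₀)
    (bound := fun y => g y + K * (‖score m y θ₀‖ + g y)) hball ?_ ?_ ?_ ?_ ?_ ?_
  · exact fun θ hθ => (measurable_psi hm hR hA hpos hs (hrΘ hθ.1.1)).aestronglyMeasurable
  · simp only [psi_self hA _ (hs _ _ hm.true_mem)]
    exact hm.integrable_score hpos
  · exact (stronglyMeasurable_fderiv_param (by
      filter_upwards [hΘ] with z hz using hm.measurable_score hpos hz)
      fun y => hm.differentiableAt_score hpos y hm.true_mem).aestronglyMeasurable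
  · refine ae_of_all _ fun y θ hθ => ?_
    have h1 := hb y θ hθ.1.1
    have h2 := hgb y θ hθ.1.2
    have h3 : ‖θ - θ₀‖ < 1 := by simpa [dist_eq_norm] using hθ.2
    have h4 : ‖score m y θ‖ ≤ ‖score m y θ₀‖ + g y := by
      have := norm_le_norm_add_norm_sub' (score m y θ) (score m y θ₀)
      nlinarith [hg0 y, norm_nonneg (θ - θ₀)]
    simp only [psi_self hA _ (hs _ _ hm.true_mem)]
    calc ‖psi R A m θ₀ y θ - score m y θ₀‖
        = ‖(psi R A m θ₀ y θ - score m y θ) + (score m y θ - score m y θ₀)‖ := by abel_nf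
      _ ≤ K * ‖θ - θ₀‖ ^ 2 * (‖score m y θ₀‖ + g y) + g y * ‖θ - θ₀‖ :=
        (norm_add_le _ _).trans (add_le_add (h1.trans (by gcongr)) h2)
      _ ≤ K * ‖θ - θ₀‖ * (‖score m y θ₀‖ + g y) + g y * ‖θ - θ₀‖ := by
        have h5 : ‖θ - θ₀‖ ^ 2 ≤ ‖θ - θ₀‖ := by nlinarith [norm_nonneg (θ - θ₀)]
        have := hg0 y
        gcongr
      _ = _ := by ring
  · exact hg.add (((hm.integrable_score hpos).norm.add hg).const_mul K)
  · exact ae_of_all _ fun y => hasFDerivAt_psi hm hR hA hc hlow y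

lemma psiSecondMoment_apply (hA : IsRAF A)
    (hs : ∀ y, 0 < R.smoothed (fun t => m t θ₀) θ₀ y) (j k : Fin d) :
    psiSecondMoment R A m θ₀ j k =
      ∫ y, score m y θ₀ j * score m y θ₀ k ∂(modelLaw m θ₀) := by
  simp only [psiSecondMoment, psi_self hA _ (hs _)]

/-- **Bartlett's identity**, entrywise. -/
lemma integral_fderiv_score_apply (hm : IsRegularModel m Θ θ₀) (hR : R.IsAdmissible Θ)
    (hA : IsRAF A) (hc : 0 < c)
    (hlow : ∀ y, ∀ θ ∈ Θ, c ≤ m y θ ∧ c ≤ R.smoothed (fun t => m t θ) θ y) (j k : Fin d) :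
    (∫ y, fderiv ℝ (score m y) θ₀ ∂(modelLaw m θ₀)) (EuclideanSpace.single k 1) j =
      -psiSecondMoment R A m θ₀ j k := by
  have hpos : ∀ y, ∀ θ ∈ Θ, 0 < m y θ := fun y θ hθ => hc.trans_le (hlow y θ hθ).1
  have hi := (hasFDerivAt_meanPsi hm hR hA hc hlow).1
  rw [psiSecondMoment_apply hA fun y => hc.trans_le (hlow y _ hm.true_mem).2,
    ← hm.integral_fderiv_score hpos, ContinuousLinearMap.integral_apply hi]
  exact ((EuclideanSpace.proj j : Param d →L[ℝ] ℝ).integral_comp_comm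
    (hi.apply_continuousLinearMap (EuclideanSpace.single k 1))).symm

lemma psiSecondMoment_eq_neg_jacobian (hm : IsRegularModel m Θ θ₀) (hR : R.IsAdmissible Θ)
    (hA : IsRAF A) (hc : 0 < c)
    (hlow : ∀ y, ∀ θ ∈ Θ, c ≤ m y θ ∧ c ≤ R.smoothed (fun t => m t θ) θ y) :
    psiSecondMoment R A m θ₀ = -jacobian (meanPsi R A m θ₀) θ₀ := by
  ext j k
  rw [Matrix.neg_apply, jacobian, (hasFDerivAt_meanPsi hm hR hA hc hlow).2.fderiv,
    integral_fderiv_score_apply hm hR hA hc hlow, neg_neg]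

/-- By the information identity the quadratic form of `A` is the mean of that of `-Ψ̇(Y; θ₀)`, which
is strictly positive at every point; a probability measure gives such a function a positive
integral. -/
lemma posDef_psiSecondMoment (hm : IsRegularModel m Θ θ₀) (hR : R.IsAdmissible Θ)
    (hA : IsRAF A) (hc : 0 < c)
    (hlow : ∀ y, ∀ θ ∈ Θ, c ≤ m y θ ∧ c ≤ R.smoothed (fun t => m t θ) θ y)
    (hdef : ∀ y, IsNegDef (jacobian (psi R A m θ₀ y) θ₀)) :
    (psiSecondMoment R A m θ₀).PosDef := by
  have := hm.isProbabilityMeasure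
  have hi := (hasFDerivAt_meanPsi hm hR hA hc hlow).1
  have hij : ∀ j k, Integrable (fun y => jacobian (psi R A m θ₀ y) θ₀ j k) (modelLaw m θ₀) := by
    intro j k
    simp only [jacobian, (hasFDerivAt_psi hm hR hA hc hlow _).fderiv]
    exact (EuclideanSpace.proj j : Param d →L[ℝ] ℝ).integrable_comp
      (hi.apply_continuousLinearMap (EuclideanSpace.single k 1))
  have hB : ∀ j k, psiSecondMoment R A m θ₀ j k =
      ∫ y, -jacobian (psi R A m θ₀ y) θ₀ j k ∂(modelLaw m θ₀) := by
    intro j k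
    rw [integral_neg, eq_neg_iff_add_eq_zero, add_comm, ← eq_neg_iff_add_eq_zero,
      psiSecondMoment_apply hA fun y => hc.trans_le (hlow y _ hm.true_mem).2,
      ← hm.integral_fderiv_score fun y θ hθ => hc.trans_le (hlow y θ hθ).1]
    simp only [jacobian, (hasFDerivAt_psi hm hR hA hc hlow _).fderiv]
  refine Matrix.PosDef.of_dotProduct_mulVec_pos ?_ fun {v} hv => ?_
  · ext j k
    simp [psiSecondMoment, mul_comm]
  · have hq : ∀ y, star v ⬝ᵥ (jacobian (psi R A m θ₀ y) θ₀ *ᵥ v) =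
        ∑ j, ∑ k, v j * v k * jacobian (psi R A m θ₀ y) θ₀ j k := fun y => by
      simp only [dotProduct, mulVec, Finset.mul_sum, star_trivial]
      refine Finset.sum_congr rfl fun j _ => Finset.sum_congr rfl fun k _ => ?_
      ring
    have hqi : Integrable (fun y => -(v ⬝ᵥ (jacobian (psi R A m θ₀ y) θ₀ *ᵥ v)))
        (modelLaw m θ₀) := by
      simp only [star_trivial] at hq
      simp only [hq]
      exact (integrable_finsetSum _ fun j _ => integrable_finsetSum _ fun k _ =>
        (hij j k).const_mul _).neg
    have he : star v ⬝ᵥ (psiSecondMoment R A m θ₀ *ᵥ v) =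
        ∫ y, -(v ⬝ᵥ (jacobian (psi R A m θ₀ y) θ₀ *ᵥ v)) ∂(modelLaw m θ₀) := by
      simp only [star_trivial] at hq
      simp only [hq, integral_neg]
      rw [integral_finsetSum _ fun j _ => integrable_finsetSum _ fun k _ => (hij j k).const_mul _]
      simp only [dotProduct, mulVec, Finset.mul_sum, star_trivial, ← Finset.sum_neg_distrib]
      refine Finset.sum_congr rfl fun j _ => ?_
      rw [integral_finsetSum _ fun k _ => (hij j k).const_mul _, ← Finset.sum_neg_distrib]
      refine Finset.sum_congr rfl fun k _ => ?_
      rw [hB, integral_const_mul, integral_neg]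
      ring
    rw [he, integral_pos_iff_support_of_nonneg (fun y => (neg_pos.2 (hdef y v hv)).le) hqi]
    have : Function.support (fun y => -(v ⬝ᵥ (jacobian (psi R A m θ₀ y) θ₀ *ᵥ v))) = Set.univ :=
      Set.eq_univ_of_forall fun y => (neg_pos.2 (hdef y v hv)).ne'
    rw [this]
    simp

end Population

/-! ### Moment bounds for averages of i.i.d. observations -/

section Averages

variable {Ω α : Type*} [MeasurableSpace Ω] [MeasurableSpace α] {P : Measure Ω}
  [IsProbabilityMeasure P] {μ : Measure α} {Y : ℕ → Ω → α}

omit [IsProbabilityMeasure P] in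
lemma integrable_mean_comp (hY : ∀ i, Measurable (Y i)) (hlaw : ∀ i, P.map (Y i) = μ)
    {f : α → ℝ} (hf : Integrable f μ) (n : ℕ) :
    Integrable (fun ω => (n : ℝ)⁻¹ * ∑ i ∈ Finset.range n, f (Y i ω)) P :=
  (integrable_finsetSum _ fun i _ => (hlaw i ▸ hf).comp_measurable (hY i)).const_mul _

omit [IsProbabilityMeasure P] in
-- An inequality, with a sign condition on the mean, so that `n = 0` is covered: the empty average
-- is `0`.
lemma integral_mean_comp_le (hY : ∀ i, Measurable (Y i)) (hlaw : ∀ i, P.map (Y i) = μ)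
    {f : α → ℝ} (hf : Integrable f μ) (h0 : 0 ≤ ∫ y, f y ∂μ) (n : ℕ) :
    ∫ ω, (n : ℝ)⁻¹ * ∑ i ∈ Finset.range n, f (Y i ω) ∂P ≤ ∫ y, f y ∂μ := by
  have h : ∀ i, ∫ ω, f (Y i ω) ∂P = ∫ y, f y ∂μ := fun i => by
    rw [← hlaw i, integral_map (hY i).aemeasurable]
    rw [hlaw i]; exact hf.aestronglyMeasurable
  rw [integral_const_mul, integral_finsetSum _ fun i _ => (hlaw i ▸ hf).comp_measurable (hY i)]
  simp only [h, Finset.sum_const, Finset.card_range, nsmul_eq_mul]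
  rcases n.eq_zero_or_pos with rfl | hn
  · simpa using h0
  · rw [inv_mul_cancel_left₀ (by positivity)]

/-- `Y j` is independent of the pair `(Y i, Y l)`, and integrating it out first kills the factor
that is centred in it. The case `i = l` is allowed and is needed for the terms in which an
observation meets itself. -/
lemma integral_kernel_mul_kernel_eq_zero (hY : ∀ i, Measurable (Y i)) (hindep : iIndepFun Y P)
    (hlaw : ∀ i, P.map (Y i) = μ) {h : α → α → ℝ} (hh : Measurable fun q : α × α => h q.1 q.2)
    (h0 : ∀ y, ∫ t, h y t ∂μ = 0) {φ : α → ℝ} (hφ : Measurable φ) {i j l : ℕ} (hij : i ≠ j)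
    (hlj : l ≠ j)
    (hint : Integrable (fun ω => h (Y i ω) (Y j ω) * h (Y i ω) (Y l ω) * φ (Y i ω)) P) :
    ∫ ω, h (Y i ω) (Y j ω) * h (Y i ω) (Y l ω) * φ (Y i ω) ∂P = 0 := by
  set G : (α × α) × α → ℝ := fun q => h q.1.1 q.2 * h q.1.1 q.1.2 * φ q.1.1 with hG
  have hGm : Measurable G := ((hh.comp ((measurable_fst.comp measurable_fst).prodMk
    measurable_snd)).mul (hh.comp measurable_fst)).mul (hφ.comp (measurable_fst.comp measurable_fst))
  have hμ : IsProbabilityMeasure μ := hlaw 0 ▸ Measure.isProbabilityMeasure_map (hY 0).aemeasurable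
  have hm2 : Measurable fun ω => (Y i ω, Y l ω) := (hY i).prodMk (hY l)
  have hpm : IsProbabilityMeasure (P.map fun ω => (Y i ω, Y l ω)) :=
    Measure.isProbabilityMeasure_map hm2.aemeasurable
  have hmap : P.map (fun ω => ((Y i ω, Y l ω), Y j ω)) =
      (P.map fun ω => (Y i ω, Y l ω)).prod μ := by
    rw [← hlaw j]
    exact (indepFun_iff_map_prod_eq_prod_map_map hm2.aemeasurable (hY j).aemeasurable).1
      (hindep.indepFun_prodMk hY i l j hij hlj)
  have he : ∫ ω, h (Y i ω) (Y j ω) * h (Y i ω) (Y l ω) * φ (Y i ω) ∂P =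
      ∫ q, G q ∂(P.map fun ω => ((Y i ω, Y l ω), Y j ω)) :=
    (integral_map (hm2.prodMk (hY j)).aemeasurable hGm.aestronglyMeasurable).symm
  have hi : Integrable G ((P.map fun ω => (Y i ω, Y l ω)).prod μ) := by
    rw [← hmap]
    exact (integrable_map_measure hGm.aestronglyMeasurable (hm2.prodMk (hY j)).aemeasurable).2 hint
  rw [he, hmap, integral_prod _ hi]
  simp [hG, mul_assoc, integral_mul_const, h0]

/-- An average of a bounded centred kernel, evaluated at one of the observations, has second
moment of order `1 / n`, also with an integrable weight. -/
lemma integral_sq_mean_kernel_mul_le (hY : ∀ i, Measurable (Y i)) (hindep : iIndepFun Y P)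
    (hlaw : ∀ i, P.map (Y i) = μ) {h : α → α → ℝ} (hh : Measurable fun q : α × α => h q.1 q.2)
    {H : ℝ} (hH : ∀ y t, |h y t| ≤ H) (h0 : ∀ y, ∫ t, h y t ∂μ = 0) {φ : α → ℝ}
    (hφ : Measurable φ) (hφ0 : ∀ y, 0 ≤ φ y) (hφi : Integrable φ μ) (n i : ℕ) :
    Integrable (fun ω => ((n : ℝ)⁻¹ * ∑ j ∈ Finset.range n, h (Y i ω) (Y j ω)) ^ 2 * φ (Y i ω)) P ∧
    ∫ ω, ((n : ℝ)⁻¹ * ∑ j ∈ Finset.range n, h (Y i ω) (Y j ω)) ^ 2 * φ (Y i ω) ∂P ≤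
      (n : ℝ)⁻¹ * (H ^ 2 * ∫ y, φ y ∂μ) := by
  have hφY : Integrable (fun ω => φ (Y i ω)) P := (hlaw i ▸ hφi).comp_measurable (hY i)
  have hφE : ∫ ω, φ (Y i ω) ∂P = ∫ y, φ y ∂μ := by
    rw [← hlaw i, integral_map (hY i).aemeasurable hφ.aestronglyMeasurable]
  have hbd : ∀ j l ω, |h (Y i ω) (Y j ω) * h (Y i ω) (Y l ω) * φ (Y i ω)| ≤ H ^ 2 * φ (Y i ω) := by
    intro j l ω
    rw [abs_mul, abs_mul, abs_of_nonneg (hφ0 _), sq]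
    have hH0 := (abs_nonneg _).trans (hH (Y i ω) (Y j ω))
    have := hφ0 (Y i ω)
    gcongr <;> exact hH _ _
  have hint : ∀ j l, Integrable (fun ω => h (Y i ω) (Y j ω) * h (Y i ω) (Y l ω) * φ (Y i ω)) P := by
    intro j l
    refine (hφY.const_mul (H ^ 2)).mono' ?_ (ae_of_all _ (hbd j l))
    exact (((hh.comp ((hY i).prodMk (hY j))).mul (hh.comp ((hY i).prodMk (hY l)))).mul
      (hφ.comp (hY i))).aestronglyMeasurable
  -- Only the `n` diagonal terms survive, so the factor `n⁻²` becomes `n⁻¹`.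
  have hterm : ∀ j l, ∫ ω, h (Y i ω) (Y j ω) * h (Y i ω) (Y l ω) * φ (Y i ω) ∂P ≤
      if j = l then H ^ 2 * ∫ y, φ y ∂μ else 0 := by
    intro j l
    split_ifs with hjl
    · rw [← hφE, ← integral_const_mul]
      exact integral_mono (hint j l) (hφY.const_mul _) fun ω => (abs_le.1 (hbd j l ω)).2
    -- If `j = i`, then `Y j` is not independent of the evaluation point, and `Y l` is integrated
    -- out instead.
    · by_cases hij : i = j
      · subst hij
        have hsw : ∀ ω, h (Y i ω) (Y i ω) * h (Y i ω) (Y l ω) * φ (Y i ω) =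
            h (Y i ω) (Y l ω) * h (Y i ω) (Y i ω) * φ (Y i ω) := fun ω => by ring
        have := hint l i
        simp only [hsw]
        exact (integral_kernel_mul_kernel_eq_zero hY hindep hlaw hh h0 hφ hjl hjl this).le
      · exact (integral_kernel_mul_kernel_eq_zero hY hindep hlaw hh h0 hφ hij (Ne.symm hjl)
          (hint j l)).le
  have hexp : ∀ ω, ((n : ℝ)⁻¹ * ∑ j ∈ Finset.range n, h (Y i ω) (Y j ω)) ^ 2 * φ (Y i ω) =
      (n : ℝ)⁻¹ ^ 2 * ∑ j ∈ Finset.range n, ∑ l ∈ Finset.range n,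
        h (Y i ω) (Y j ω) * h (Y i ω) (Y l ω) * φ (Y i ω) := fun ω => by
    simp only [← Finset.sum_mul, ← Finset.sum_mul_sum]
    ring
  simp only [hexp]
  refine ⟨(integrable_finsetSum _ fun j _ => integrable_finsetSum _ fun l _ =>
    hint j l).const_mul _, ?_⟩
  rw [integral_const_mul,
    integral_finsetSum _ fun j _ => integrable_finsetSum _ fun l _ => hint j l]
  calc _ ≤ (n : ℝ)⁻¹ ^ 2 * ∑ j ∈ Finset.range n, ∑ l ∈ Finset.range n,
        (if j = l then H ^ 2 * ∫ y, φ y ∂μ else 0) := by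
        gcongr with j hj
        rw [integral_finsetSum _ fun l _ => hint j l]
        gcongr with l hl
        exact hterm j l
    _ = (n : ℝ)⁻¹ * (H ^ 2 * ∫ y, φ y ∂μ) := by
        rw [Finset.sum_congr rfl fun j hj => by rw [Finset.sum_ite_eq, if_pos hj]]
        simp only [Finset.sum_const, Finset.card_range, nsmul_eq_mul]
        rcases n.eq_zero_or_pos with rfl | hn
        · simp
        · field_simp

end Averages

/-- Normalized sums of centred i.i.d. vectors are bounded in `L²`. -/
lemma integral_norm_sq_inv_sqrt_smul_sum_le {Ω : Type*} [MeasurableSpace Ω] {P : Measure Ω}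
    [IsProbabilityMeasure P] {d : ℕ} {X : ℕ → Ω → EuclideanSpace ℝ (Fin d)}
    (hindep : iIndepFun X P) (hident : ∀ i, IdentDistrib (X i) (X 0) P P)
    (h2 : MemLp (X 0) 2 P) (h0 : ∫ ω, X 0 ω ∂P = 0) (n : ℕ) :
    Integrable (fun ω => ‖(Real.sqrt n)⁻¹ • ∑ i ∈ Finset.range n, X i ω‖ ^ 2) P ∧
    ∫ ω, ‖(Real.sqrt n)⁻¹ • ∑ i ∈ Finset.range n, X i ω‖ ^ 2 ∂P ≤ ∫ ω, ‖X 0 ω‖ ^ 2 ∂P := by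
  have h2' : ∀ i, MemLp (X i) 2 P := fun i => (hident i).memLp_iff.2 h2
  have h2ij : ∀ i j, Integrable (fun ω => (inner ℝ (X i ω) (X j ω) : ℝ)) P := fun i j => by
    have h1 := (h2' i).norm.integrable_mul (h2' j).norm
    exact h1.mono ((h2' i).1.inner (h2' j).1) (ae_of_all _ fun ω => by
      simpa using norm_inner_le_norm (𝕜 := ℝ) (X i ω) (X j ω))
  have hmean : ∀ i, ∫ ω, X i ω ∂P = 0 := fun i => by rw [(hident i).integral_eq, h0]
  have hzero : ∀ i j, i ≠ j → ∫ ω, (inner ℝ (X i ω) (X j ω) : ℝ) ∂P = 0 := fun i j hij => by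
    have hc : ∀ i (r : Fin d), Integrable (fun ω => X i ω r) P := fun i r =>
      (EuclideanSpace.proj r : EuclideanSpace ℝ (Fin d) →L[ℝ] ℝ).integrable_comp
        ((h2' i).integrable (by norm_num))
    have hc0 : ∀ i (r : Fin d), ∫ ω, X i ω r ∂P = 0 := fun i r => by
      have := (EuclideanSpace.proj r : EuclideanSpace ℝ (Fin d) →L[ℝ] ℝ).integral_comp_comm
        ((h2' i).integrable (by norm_num))
      simpa [hmean] using this
    have hind : ∀ r : Fin d, IndepFun (fun ω => X i ω r) (fun ω => X j ω r) P := fun r =>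
      (hindep.indepFun hij).comp (φ := fun x : EuclideanSpace ℝ (Fin d) => x r)
        (ψ := fun x : EuclideanSpace ℝ (Fin d) => x r) (by fun_prop) (by fun_prop)
    simp only [PiLp.inner_apply]
    rw [integral_finsetSum]
    · refine Finset.sum_eq_zero fun r _ => ?_
      have := (hind r).symm.integral_fun_mul_eq_mul_integral (hc j r).1 (hc i r).1
      rw [hc0, zero_mul] at this
      simpa using this
    · intro r _
      have := (hind r).symm.integrable_mul (hc j r) (hc i r)
      simpa [Pi.mul_def] using this
  have hexp : ∀ ω, ‖(Real.sqrt n)⁻¹ • ∑ i ∈ Finset.range n, X i ω‖ ^ 2 =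
      (n : ℝ)⁻¹ * ∑ i ∈ Finset.range n, ∑ j ∈ Finset.range n, inner ℝ (X i ω) (X j ω) := fun ω => by
    rw [norm_smul, mul_pow, norm_inv, inv_pow, Real.norm_of_nonneg (Real.sqrt_nonneg _),
      Real.sq_sqrt n.cast_nonneg, ← real_inner_self_eq_norm_sq, sum_inner]
    simp only [inner_sum]
  simp only [hexp]
  refine ⟨(integrable_finsetSum _ fun i _ => integrable_finsetSum _ fun j _ =>
    h2ij i j).const_mul _, ?_⟩
  rw [integral_const_mul,
    integral_finsetSum _ fun i _ => integrable_finsetSum _ fun j _ => h2ij i j]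
  have hdiag : ∀ i, ∫ ω, (inner ℝ (X i ω) (X i ω) : ℝ) ∂P = ∫ ω, ‖X 0 ω‖ ^ 2 ∂P := fun i => by
    simp only [real_inner_self_eq_norm_sq]
    exact ((hident i).comp (u := fun x => ‖x‖ ^ 2) (by fun_prop)).integral_eq
  have hsum : ∀ i ∈ Finset.range n, ∫ ω, ∑ j ∈ Finset.range n, (inner ℝ (X i ω) (X j ω) : ℝ) ∂P =
      ∫ ω, ‖X 0 ω‖ ^ 2 ∂P := fun i hi => by
    rw [integral_finsetSum _ fun j _ => h2ij i j, Finset.sum_eq_single_of_mem i hi, hdiag]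
    exact fun j _ hj => hzero i j hj.symm
  rw [Finset.sum_congr rfl hsum]
  simp only [Finset.sum_const, Finset.card_range, nsmul_eq_mul]
  rcases n.eq_zero_or_pos with rfl | hn
  · simpa using integral_nonneg fun ω => by positivity
  · rw [inv_mul_cancel_left₀ (by positivity)]

/-! ### Nonnegative random variables that tend to zero in mean -/

/-- A sequence of nonnegative integrable random variables whose expectations tend to zero. -/
structure TendstoZeroInMean {Ω : Type*} [MeasurableSpace Ω] (P : Measure Ω) (X : ℕ → Ω → ℝ) :
    Prop where
  nonneg : ∀ n ω, 0 ≤ X n ω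
  integrable : ∀ n, Integrable (X n) P
  tendsto : Tendsto (fun n => ∫ ω, X n ω ∂P) atTop (𝓝 0)

namespace TendstoZeroInMean

variable {Ω : Type*} [MeasurableSpace Ω] {P : Measure Ω} {X X' S : ℕ → Ω → ℝ}

lemma of_integral_le (h0 : ∀ n ω, 0 ≤ X n ω) (hi : ∀ n, Integrable (X n) P) {b : ℕ → ℝ}
    (hb : Tendsto b atTop (𝓝 0)) (hle : ∀ n, ∫ ω, X n ω ∂P ≤ b n) : TendstoZeroInMean P X :=
  ⟨h0, hi, squeeze_zero (fun n => integral_nonneg (h0 n)) hle hb⟩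

lemma add (h : TendstoZeroInMean P X) (h' : TendstoZeroInMean P X') :
    TendstoZeroInMean P fun n ω => X n ω + X' n ω :=
  ⟨fun n ω => add_nonneg (h.nonneg n ω) (h'.nonneg n ω),
    fun n => (h.integrable n).add (h'.integrable n), by
      simp only [fun n => integral_add (h.integrable n) (h'.integrable n)]
      simpa using h.tendsto.add h'.tendsto⟩

lemma sum {ι : Type*} (s : Finset ι) {X : ι → ℕ → Ω → ℝ} (h : ∀ k, TendstoZeroInMean P (X k)) :
    TendstoZeroInMean P fun n ω => ∑ k ∈ s, X k n ω :=
  ⟨fun n ω => Finset.sum_nonneg fun k _ => (h k).nonneg n ω,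
    fun n => integrable_finsetSum _ fun k _ => (h k).integrable n, by
      simp only [fun n => integral_finsetSum s fun k _ => (h k).integrable n]
      simpa using tendsto_finsetSum s fun k _ => (h k).tendsto⟩

lemma mono (h : TendstoZeroInMean P X) (h0 : ∀ n ω, 0 ≤ X' n ω)
    (hm : ∀ n, AEStronglyMeasurable (X' n) P) (hle : ∀ n ω, X' n ω ≤ X n ω) :
    TendstoZeroInMean P X' := by
  have hi : ∀ n, Integrable (X' n) P := fun n => (h.integrable n).mono' (hm n)
    (ae_of_all _ fun ω => by rw [Real.norm_of_nonneg (h0 n ω)]; exact hle n ω)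
  exact of_integral_le h0 hi h.tendsto fun n => integral_mono (hi n) (h.integrable n) (hle n)

/-- A product with a sequence that is bounded in mean can be split into two null sequences. -/
lemma exists_rate (h : TendstoZeroInMean P X) (hS0 : ∀ n ω, 0 ≤ S n ω)
    (hSi : ∀ n, Integrable (S n) P) {b : ℝ} (hSb : ∀ n, ∫ ω, S n ω ∂P ≤ b) :
    ∃ η : ℕ → ℝ, (∀ n, 0 < η n) ∧ TendstoZeroInMean P (fun n ω => (η n)⁻¹ * X n ω) ∧
      TendstoZeroInMean P fun n ω => η n * S n ω := by
  set e : ℕ → ℝ := fun n => ∫ ω, X n ω ∂P with he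
  have he0 : ∀ n, 0 ≤ e n := fun n => integral_nonneg (h.nonneg n)
  have hpos : ∀ n : ℕ, 0 < e n + 1 / ((n : ℝ) + 1) := fun n =>
    add_pos_of_nonneg_of_pos (he0 n) (by positivity)
  -- With `η² ≥ e`, the mean of `η⁻¹ X` is at most `η`, which tends to `0`. The term `1 / (n + 1)`
  -- keeps `η` positive when `e n = 0`.
  set η : ℕ → ℝ := fun n => Real.sqrt (e n + 1 / ((n : ℝ) + 1)) with hη
  have hη0 : ∀ n, 0 < η n := fun n => Real.sqrt_pos.2 (hpos n)
  have hηt : Tendsto η atTop (𝓝 0) := by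
    have := (h.tendsto.add (tendsto_one_div_add_atTop_nhds_zero_nat (𝕜 := ℝ))).sqrt
    simpa [hη, he] using this
  refine ⟨η, hη0, of_integral_le (b := η) (fun n ω => mul_nonneg (inv_nonneg.2 (hη0 n).le)
    (h.nonneg n ω)) (fun n => (h.integrable n).const_mul _) hηt fun n => ?_,
    of_integral_le (b := fun n => η n * b) (fun n ω => mul_nonneg (hη0 n).le (hS0 n ω))
    (fun n => (hSi n).const_mul _) (by simpa using hηt.mul_const b) fun n => ?_⟩
  · rw [integral_const_mul, inv_mul_le_iff₀ (hη0 n), Real.mul_self_sqrt (hpos n).le]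
    have : (0 : ℝ) ≤ 1 / ((n : ℝ) + 1) := by positivity
    simpa [he] using this
  · rw [integral_const_mul]
    exact mul_le_mul_of_nonneg_left (hSb n) (hη0 n).le

/-- Convergence in mean implies convergence in measure. Starting from an arbitrary subsequence is
what the subsequence criterion for convergence in probability requires. -/
lemma exists_subseq_ae (h : TendstoZeroInMean P X) {ns : ℕ → ℕ} (hns : StrictMono ns) :
    ∃ ns' : ℕ → ℕ, StrictMono ns' ∧
      ∀ᵐ ω ∂P, Tendsto (fun i => X (ns (ns' i)) ω) atTop (𝓝 0) := by
  have hm : TendstoInMeasure P X atTop 0 := by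
    refine tendstoInMeasure_of_tendsto_eLpNorm (p := 1) one_ne_zero
      (fun n => (h.integrable n).1) aestronglyMeasurable_zero ?_
    have he : ∀ n, eLpNorm (X n - 0) 1 P = ENNReal.ofReal (∫ ω, X n ω ∂P) := fun n => by
      rw [sub_zero, eLpNorm_one_eq_lintegral_enorm,
        ofReal_integral_eq_lintegral_ofReal (h.integrable n) (ae_of_all _ (h.nonneg n))]
      simp only [Real.enorm_of_nonneg (h.nonneg n _)]
    simp only [he]
    simpa using ENNReal.tendsto_ofReal h.tendsto
  exact (hm.comp hns.tendsto_atTop).exists_seq_tendsto_ae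

end TendstoZeroInMean

/-! ### The finite sample estimating function -/

section Sample

variable {p d : ℕ} {m : Torus p → Param d → ℝ} {Θ : Set (Param d)} {θ₀ : Param d}
  {R : PearsonKind p d} {A : ℝ → ℝ} {c : ℝ}

/-- The average of the estimating function over the sample. -/
def meanPsiN (R : PearsonKind p d) (A : ℝ → ℝ) (m : Torus p → Param d → ℝ) (ys : ℕ → Torus p)
    (n : ℕ) (θ : Param d) : Param d :=
  (n : ℝ)⁻¹ • ∑ i ∈ Finset.range n, psiN R A m ys n (ys i) θ

/-- The average of the score over the sample. -/
def meanScore (m : Torus p → Param d → ℝ) (ys : ℕ → Torus p) (n : ℕ) (θ : Param d) : Param d :=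
  (n : ℝ)⁻¹ • ∑ i ∈ Finset.range n, score m (ys i) θ

/-- The average of the norm of the score over the sample. -/
def meanScoreNorm (m : Torus p → Param d → ℝ) (ys : ℕ → Torus p) (n : ℕ) (θ : Param d) : ℝ :=
  (n : ℝ)⁻¹ * ∑ i ∈ Finset.range n, ‖score m (ys i) θ‖

/-- The mean squared error of the kernel density estimate over the sample, weighted by the norm of
the score. -/
def kdeError (R : PearsonKind p d) (m : Torus p → Param d → ℝ) (θ₀ : Param d) (ys : ℕ → Torus p)
    (n : ℕ) (θ : Param d) : ℝ :=
  (n : ℝ)⁻¹ * ∑ i ∈ Finset.range n,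
    (R.kde ys n θ (ys i) - R.smoothed (fun t => m t θ₀) θ (ys i)) ^ 2 * ‖score m (ys i) θ‖

lemma meanScoreNorm_nonneg (ys : ℕ → Torus p) (n : ℕ) (θ : Param d) :
    0 ≤ meanScoreNorm m ys n θ := by
  unfold meanScoreNorm; positivity

lemma kdeError_nonneg (ys : ℕ → Torus p) (n : ℕ) (θ : Param d) :
    0 ≤ kdeError R m θ₀ ys n θ := by
  unfold kdeError; positivity

/-- Near `θ₀` the weighted estimating function is close to the score. -/
lemma exists_norm_meanPsiN_sub_meanScore_le (hm : IsRegularModel m Θ θ₀) (hR : R.IsAdmissible Θ)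
    (hA : IsRAF A) (hc : 0 < c)
    (hlow : ∀ y, ∀ θ ∈ Θ, c ≤ m y θ ∧ c ≤ R.smoothed (fun t => m t θ) θ y) :
    ∃ r > 0, ∃ C, 0 ≤ C ∧ Metric.ball θ₀ r ⊆ Θ ∧ ∀ ys n, ∀ θ ∈ Metric.ball θ₀ r,
      ‖meanPsiN R A m ys n θ - meanScore m ys n θ‖ ≤
        C * (kdeError R m θ₀ ys n θ + ‖θ - θ₀‖ ^ 2 * meanScoreNorm m ys n θ) := by
  obtain ⟨r, hr, K, hK, hrΘ, hb⟩ := exists_abs_smoothed_sub_le (R := R) hm hR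
    fun y θ hθ => hc.trans_le (hlow y θ hθ).1
  obtain ⟨C, hC, hw⟩ := hA.exists_abs_weight_sub_one_le
  refine ⟨r, hr, C * (2 * ((c⁻¹) ^ 2 + (K / c) ^ 2)), by positivity, hrΘ, fun ys n θ hθ => ?_⟩
  have hterm : ∀ y, ‖psiN R A m ys n y θ - score m y θ‖ ≤ C * (2 * ((c⁻¹) ^ 2 + (K / c) ^ 2)) *
      ((R.kde ys n θ y - R.smoothed (fun t => m t θ₀) θ y) ^ 2 * ‖score m y θ‖ +
        ‖θ - θ₀‖ ^ 2 * ‖score m y θ‖) := fun y => by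
    have hs := hc.trans_le (hlow y θ (hrΘ hθ)).2
    have h1 := abs_residual_le hc (hlow y θ (hrΘ hθ)).2 (hb y θ hθ)
    have h2 := hw _ (neg_one_le_residualN hR ys n y hs)
    have h3 : psiN R A m ys n y θ - score m y θ =
        (weight A (R.residualN m ys n y θ) - 1) • score m y θ := by
      rw [psiN, sub_smul, one_smul]
    set e := R.kde ys n θ y - R.smoothed (fun t => m t θ₀) θ y with he
    -- The sample residual splits into the sampling error, over the smoothed model density, and the
    -- population residual; `(a + b)² ≤ 2 (a² + b²)` gives the factor `2` in the constant.
    have h4 : R.residualN m ys n y θ = e / R.smoothed (fun t => m t θ) θ y +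
        R.residual m θ₀ y θ := by
      rw [PearsonKind.residualN, PearsonKind.residual, he]
      ring
    have h5 : (e / R.smoothed (fun t => m t θ) θ y) ^ 2 ≤ (c⁻¹) ^ 2 * e ^ 2 := by
      rw [div_eq_mul_inv, mul_pow, mul_comm]
      have := (hlow y θ (hrΘ hθ)).2
      gcongr
    have h6 : R.residual m θ₀ y θ ^ 2 ≤ (K / c) ^ 2 * ‖θ - θ₀‖ ^ 2 := by
      rw [← mul_pow, ← sq_abs]
      gcongr
    have h7 : R.residualN m ys n y θ ^ 2 ≤
        2 * ((c⁻¹) ^ 2 + (K / c) ^ 2) * (e ^ 2 + ‖θ - θ₀‖ ^ 2) := by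
      rw [h4]
      have h8 := add_sq_le (a := e / R.smoothed (fun t => m t θ) θ y) (b := R.residual m θ₀ y θ)
      have h9 : 0 ≤ (c⁻¹) ^ 2 * ‖θ - θ₀‖ ^ 2 := by positivity
      have h10 : 0 ≤ (K / c) ^ 2 * e ^ 2 := by positivity
      linarith
    rw [h3, norm_smul, Real.norm_eq_abs, ← add_mul, ← mul_assoc, mul_assoc C]
    gcongr
    exact h2.trans (by gcongr)
  have hmain : meanPsiN R A m ys n θ - meanScore m ys n θ =
      (n : ℝ)⁻¹ • ∑ i ∈ Finset.range n, (psiN R A m ys n (ys i) θ - score m (ys i) θ) := by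
    rw [meanPsiN, meanScore, ← smul_sub, Finset.sum_sub_distrib]
  rw [hmain, norm_smul, norm_inv, Real.norm_natCast, kdeError, meanScoreNorm]
  calc _ ≤ (n : ℝ)⁻¹ * ∑ i ∈ Finset.range n, C * (2 * ((c⁻¹) ^ 2 + (K / c) ^ 2)) *
      ((R.kde ys n θ (ys i) - R.smoothed (fun t => m t θ₀) θ (ys i)) ^ 2 * ‖score m (ys i) θ‖ +
        ‖θ - θ₀‖ ^ 2 * ‖score m (ys i) θ‖) := by
        gcongr
        exact norm_sum_le_of_le _ fun i _ => hterm _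
    _ = _ := by
        rw [← Finset.mul_sum, Finset.sum_add_distrib, ← Finset.mul_sum]
        ring

section Random

variable {Ω : Type*} [MeasurableSpace Ω] {P : Measure Ω} [IsProbabilityMeasure P]
  {Y : ℕ → Ω → Torus p}

/-- At fixed `θ` and `y` the kernel has mean `R.smoothed (fun t => m t θ₀) θ y` under the true law,
so the error of the estimate is an average of a centred kernel. The kernel and its mean both lie in
`[0, M]`, whence the constant `M ^ 2`. -/
lemma exists_integral_kdeError_le (hm : IsRegularModel m Θ θ₀) (hR : R.IsAdmissible Θ)
    (hpos : ∀ y, ∀ θ ∈ Θ, 0 < m y θ) (hY : ∀ i, Measurable (Y i)) (hindep : iIndepFun Y P)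
    (hlaw : ∀ i, P.map (Y i) = modelLaw m θ₀) :
    ∃ H, 0 ≤ H ∧ ∀ n, ∀ θ ∈ Θ, Integrable (fun y => ‖score m y θ‖) (modelLaw m θ₀) →
      Integrable (fun ω => kdeError R m θ₀ (fun i => Y i ω) n θ) P ∧
      ∫ ω, kdeError R m θ₀ (fun i => Y i ω) n θ ∂P ≤
        (n : ℝ)⁻¹ * (H * ∫ y, ‖score m y θ‖ ∂(modelLaw m θ₀)) := by
  obtain ⟨M, hM, hk⟩ := hR.exists_kernel_le
  refine ⟨M ^ 2, by positivity, fun n θ hθ hint => ?_⟩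
  have hμ := hm.isProbabilityMeasure
  set s : Torus p → ℝ := R.smoothed (fun t => m t θ₀) θ with hs
  have hsm : Measurable s := hR.measurable_smoothed (hm.measurable _ hm.true_mem) θ
  have hs0 : ∀ y, 0 ≤ s y := fun y => hR.smoothed_nonneg (fun t => hm.nonneg t _ hm.true_mem) _ _
  have hk1 : Integrable (fun _ : Torus p => (1 : ℝ)) (modelLaw m θ₀) := integrable_const _
  have hkint : ∀ y, Integrable (fun t => R.kernel θ y t) (modelLaw m θ₀) := fun y => by
    simpa using hR.integrable_kernel_mul hk1 θ y
  have hsint : ∀ y, ∫ t, R.kernel θ y t ∂(modelLaw m θ₀) = s y := fun y => by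
    rw [hm.integral_modelLaw]
    simp only [smul_eq_mul, mul_comm (m _ θ₀), hs]
    rfl
  have hsM : ∀ y, s y ≤ M := fun y => by
    rw [← hsint y]
    calc _ ≤ ∫ t, M ∂(modelLaw m θ₀) := integral_mono (hkint y) (integrable_const _) (hk θ y)
      _ = M := by simp
  have hH : ∀ y t, |R.kernel θ y t - s y| ≤ M := fun y t => by
    rw [abs_le]
    constructor <;> linarith [hk θ y t, hR.kernel_nonneg θ y t, hs0 y, hsM y]
  have h0 : ∀ y, ∫ t, (R.kernel θ y t - s y) ∂(modelLaw m θ₀) = 0 := fun y => by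
    rw [integral_sub (hkint y) (integrable_const _), hsint]
    simp
  have key := integral_sq_mean_kernel_mul_le (h := fun y t => R.kernel θ y t - s y) hY hindep hlaw
    ((hR.measurable_kernel θ).sub (hsm.comp measurable_fst)) hH h0
    (hm.measurable_score hpos hθ).norm (fun _ => norm_nonneg _) hint n
  have he : ∀ ω, kdeError R m θ₀ (fun i => Y i ω) n θ = (n : ℝ)⁻¹ * ∑ i ∈ Finset.range n,
      ((n : ℝ)⁻¹ * ∑ j ∈ Finset.range n, (R.kernel θ (Y i ω) (Y j ω) - s (Y i ω))) ^ 2 *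
        ‖score m (Y i ω) θ‖ := fun ω => by
    rw [kdeError]
    congr 1
    refine Finset.sum_congr rfl fun i hi => ?_
    have hn : (n : ℝ) ≠ 0 := Nat.cast_ne_zero.2 (by have := Finset.mem_range.1 hi; omega)
    rw [Finset.sum_sub_distrib, mul_sub, PearsonKind.kde, Finset.sum_const, Finset.card_range,
      nsmul_eq_mul, inv_mul_cancel_left₀ hn]
  simp only [he]
  refine ⟨(integrable_finsetSum _ fun i _ => (key i).1).const_mul _, ?_⟩
  rw [integral_const_mul, integral_finsetSum _ fun i _ => (key i).1]
  calc _ ≤ (n : ℝ)⁻¹ * ∑ i ∈ Finset.range n,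
        (n : ℝ)⁻¹ * (M ^ 2 * ∫ y, ‖score m y θ‖ ∂(modelLaw m θ₀)) := by
        gcongr with i hi
        exact (key i).2
    _ = _ := by
        simp only [Finset.sum_const, Finset.card_range, nsmul_eq_mul]
        rcases n.eq_zero_or_pos with rfl | hn
        · simp
        · rw [inv_mul_cancel_left₀ (by positivity)]

lemma integrable_fderiv_score_apply (hm : IsRegularModel m Θ θ₀)
    (hpos : ∀ y, ∀ θ ∈ Θ, 0 < m y θ) {g : Torus p → ℝ} (hg : Integrable g (modelLaw m θ₀))
    (hgd : ∀ y, ‖fderiv ℝ (score m y) θ₀‖ ≤ g y) (v : Param d) :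
    Measurable (fun y => fderiv ℝ (score m y) θ₀ v) ∧
      Integrable (fun y => fderiv ℝ (score m y) θ₀ v) (modelLaw m θ₀) := by
  have hmeas : Measurable (fun y => fderiv ℝ (score m y) θ₀ v) :=
    measurable_fderiv_apply_param (by
      filter_upwards [hm.mem_nhds hm.true_mem] with z hz using hm.measurable_score hpos hz)
      (fun y => hm.differentiableAt_score hpos y hm.true_mem) v
  exact ⟨hmeas, (hg.mul_const ‖v‖).mono' hmeas.aestronglyMeasurable
    (ae_of_all _ fun y => (fderiv ℝ (score m y) θ₀).le_of_opNorm_le (hgd y) v)⟩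

/-- Difference quotients of the averaged score, with vanishing increments, converge in mean to the
mean derivative of the score. -/
lemma tendstoZeroInMean_score_quotient (hm : IsRegularModel m Θ θ₀)
    (hpos : ∀ y, ∀ θ ∈ Θ, 0 < m y θ) (hY : ∀ i, Measurable (Y i)) (hindep : iIndepFun Y P)
    (hlaw : ∀ i, P.map (Y i) = modelLaw m θ₀) {r : ℝ} (hrΘ : Metric.ball θ₀ r ⊆ Θ)
    {g : Torus p → ℝ} (hg : Integrable g (modelLaw m θ₀))
    (hgd : ∀ y, ‖fderiv ℝ (score m y) θ₀‖ ≤ g y)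
    (hgb : ∀ y, ∀ θ ∈ Metric.ball θ₀ r, ‖score m y θ - score m y θ₀‖ ≤ g y * ‖θ - θ₀‖)
    {t : ℕ → ℝ} (ht0 : ∀ n, 0 < t n) (ht : Tendsto t atTop (𝓝 0)) {v : Param d}
    (hmem : ∀ n, θ₀ + t n • v ∈ Metric.ball θ₀ r) :
    TendstoZeroInMean P fun n ω =>
      ‖(t n)⁻¹ • (meanScore m (fun i => Y i ω) n (θ₀ + t n • v) -
          meanScore m (fun i => Y i ω) n θ₀) -
        ∫ y, fderiv ℝ (score m y) θ₀ v ∂(modelLaw m θ₀)‖ := by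
  obtain ⟨hDm, hDi⟩ := integrable_fderiv_score_apply hm hpos hg hgd v
  set D : Torus p → Param d := fun y => fderiv ℝ (score m y) θ₀ v with hD
  set L : Param d := ∫ y, D y ∂(modelLaw m θ₀) with hL
  set q : ℕ → Torus p → ℝ := fun n y =>
    ‖(t n)⁻¹ • (score m y (θ₀ + t n • v) - score m y θ₀) - D y‖ with hq
  have hsm : ∀ n, Measurable fun y => score m y (θ₀ + t n • v) := fun n =>
    hm.measurable_score hpos (hrΘ (hmem n))
  have hsm0 : Measurable fun y => score m y θ₀ := hm.measurable_score hpos hm.true_mem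
  have hqm : ∀ n, Measurable (q n) := fun n =>
    ((((hsm n).sub hsm0).const_smul (t n)⁻¹).sub hDm).norm
  have hqb : ∀ n y, ‖q n y‖ ≤ 2 * (g y * ‖v‖) := fun n y => by
    have h1 := hgb y _ (hmem n)
    rw [add_sub_cancel_left, norm_smul, Real.norm_of_nonneg (ht0 n).le] at h1
    have h2 : ‖D y‖ ≤ g y * ‖v‖ := (fderiv ℝ (score m y) θ₀).le_of_opNorm_le (hgd y) v
    have h3 : ‖(t n)⁻¹ • (score m y (θ₀ + t n • v) - score m y θ₀)‖ ≤ g y * ‖v‖ := by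
      rw [norm_smul, norm_inv, Real.norm_of_nonneg (ht0 n).le, inv_mul_le_iff₀ (ht0 n)]
      linarith
    rw [norm_norm]
    linarith [norm_sub_le ((t n)⁻¹ • (score m y (θ₀ + t n • v) - score m y θ₀)) (D y)]
  have hbi : Integrable (fun y => 2 * (g y * ‖v‖)) (modelLaw m θ₀) :=
    (hg.mul_const _).const_mul _
  have hqi : ∀ n, Integrable (q n) (modelLaw m θ₀) := fun n =>
    hbi.mono' (hqm n).aestronglyMeasurable (ae_of_all _ (hqb n))
  -- The quotients converge for each `y` and are dominated through the Lipschitz function `g`;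
  -- averaging over the sample does not change this mean bound.
  have hqt : Tendsto (fun n => ∫ y, q n y ∂(modelLaw m θ₀)) atTop (𝓝 0) := by
    have := tendsto_integral_of_dominated_convergence (μ := modelLaw m θ₀) (F := q)
      (f := fun _ => 0) _ (fun n => (hqm n).aestronglyMeasurable) hbi
      (fun n => ae_of_all _ (hqb n)) (ae_of_all _ fun y => ?_)
    · simpa using this
    · have hc : Tendsto (fun n => ‖(t n)⁻¹‖) atTop atTop :=
        tendsto_norm_atTop_atTop.comp (Tendsto.inv_tendsto_nhdsGT_zero
          (tendsto_nhdsWithin_iff.2 ⟨ht, Eventually.of_forall ht0⟩))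
      have h1 := (hm.differentiableAt_score hpos y hm.true_mem).hasFDerivAt.lim v hc
      simp only [inv_inv] at h1
      simpa [hq, hD] using (h1.sub_const (D y)).norm
  have hav : TendstoZeroInMean P fun n ω =>
      (n : ℝ)⁻¹ * ∑ i ∈ Finset.range n, q n (Y i ω) :=
    .of_integral_le (fun n ω => by positivity) (fun n => integrable_mean_comp hY hlaw (hqi n) n)
      hqt fun n => integral_mean_comp_le hY hlaw (hqi n) (integral_nonneg fun _ => norm_nonneg _) n
  have hDY : ∀ i, Integrable (fun ω => D (Y i ω)) P := fun i =>
    (hlaw i ▸ hDi).comp_measurable (hY i)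
  have hmean : ∫ ω, D (Y 0 ω) ∂P = L := by
    rw [hL, ← hlaw 0, integral_map (hY 0).aemeasurable hDm.aestronglyMeasurable]
  -- The remaining error is the law of large numbers in `L¹` for the fixed function `D`.
  have hlln : TendstoZeroInMean P fun n ω =>
      ‖(n : ℝ)⁻¹ • ∑ i ∈ Finset.range n, D (Y i ω) - L‖ := by
    have hi : ∀ n : ℕ, Integrable (fun ω => (n : ℝ)⁻¹ • ∑ i ∈ Finset.range n, D (Y i ω) - L) P :=
      fun n => ((integrable_finsetSum _ fun i _ => hDY i).smul (n : ℝ)⁻¹).sub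
        (integrable_const _)
    refine ⟨fun n ω => norm_nonneg _, fun n => (hi n).norm, ?_⟩
    have h := strong_law_Lp (p := 1) le_rfl (by norm_num) (fun i ω => D (Y i ω))
      (memLp_one_iff_integrable.2 (hDY 0))
      (fun i j hij => (hindep.indepFun hij).comp hDm hDm)
      (fun i => (IdentDistrib.mk (hY i).aemeasurable (hY 0).aemeasurable
        (by rw [hlaw i, hlaw 0])).comp hDm)
    rw [hmean] at h
    have h' := (ENNReal.tendsto_toReal ENNReal.zero_ne_top).comp h
    refine h'.congr fun n => ?_
    simp only [Function.comp_apply]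
    rw [eLpNorm_one_eq_lintegral_enorm, integral_norm_eq_lintegral_enorm (hi n).1]
  refine (hav.add hlln).mono (fun n ω => norm_nonneg _) (fun n => ?_) fun n ω => ?_
  · have h1 : ∀ θ, (Measurable fun y => score m y θ) →
        Measurable fun ω => meanScore m (fun i => Y i ω) n θ := fun θ hθ =>
      Measurable.const_smul (c := (n : ℝ)⁻¹)
        (Finset.measurable_fun_sum (Finset.range n) fun i _ => hθ.comp (hY i))
    exact ((((h1 _ (hsm n)).sub (h1 _ hsm0)).const_smul (t n)⁻¹).sub_const
      L).norm.aestronglyMeasurable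
  · have he : (t n)⁻¹ • (meanScore m (fun i => Y i ω) n (θ₀ + t n • v) -
        meanScore m (fun i => Y i ω) n θ₀) - L =
        (n : ℝ)⁻¹ • ∑ i ∈ Finset.range n,
          ((t n)⁻¹ • (score m (Y i ω) (θ₀ + t n • v) - score m (Y i ω) θ₀) - D (Y i ω)) +
        ((n : ℝ)⁻¹ • ∑ i ∈ Finset.range n, D (Y i ω) - L) := by
      rw [meanScore, meanScore, Finset.sum_sub_distrib, ← Finset.smul_sum, Finset.sum_sub_distrib]
      module
    rw [he]
    refine (norm_add_le _ _).trans (add_le_add ?_ le_rfl)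
    rw [norm_smul, norm_inv, Real.norm_natCast]
    gcongr
    exact norm_sum_le _ _

end Random

end Sample

/-! ### Zeros of monotone estimating equations -/

section Deterministic

variable {E : Type*} [NormedAddCommGroup E] [InnerProductSpace ℝ E] {Θ : Set E} {θ₀ : E}

lemma norm_fderiv_sub_le {F : Type*} [NormedAddCommGroup F] [NormedSpace ℝ F] {f : E → F} {C : ℝ}
    (hΘ : IsOpen Θ) (hc : Convex ℝ Θ) (hd : DifferentiableOn ℝ (fderiv ℝ f) Θ)
    (hC : ∀ θ ∈ Θ, ‖fderiv ℝ (fderiv ℝ f) θ‖ ≤ C) :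
    ∀ θ ∈ Θ, ∀ θ' ∈ Θ, ‖fderiv ℝ f θ' - fderiv ℝ f θ‖ ≤ C * ‖θ' - θ‖ := fun _ hθ _ hθ' =>
  hc.norm_image_sub_le_of_norm_fderiv_le (𝕜 := ℝ)
    (fun _ hz => hd.differentiableAt (hΘ.mem_nhds hz)) hC hθ hθ'

/-- First order Taylor expansion of a function with Lipschitz derivative. -/
lemma norm_taylor_le {F : Type*} [NormedAddCommGroup F] [NormedSpace ℝ F] {f : E → F} {C : ℝ}
    (hC0 : 0 ≤ C) (hc : Convex ℝ Θ) (hd : ∀ θ ∈ Θ, DifferentiableAt ℝ f θ)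
    (hC : ∀ θ ∈ Θ, ∀ θ' ∈ Θ, ‖fderiv ℝ f θ' - fderiv ℝ f θ‖ ≤ C * ‖θ' - θ‖)
    {θ θ' : E} (hθ : θ ∈ Θ) (hθ' : θ' ∈ Θ) :
    ‖f θ' - f θ - fderiv ℝ f θ (θ' - θ)‖ ≤ C * ‖θ' - θ‖ ^ 2 := by
  have h := (hc.inter (convex_closedBall θ ‖θ' - θ‖)).norm_image_sub_le_of_norm_fderiv_le'
    (𝕜 := ℝ) (f := f) (φ := fderiv ℝ f θ) (C := C * ‖θ' - θ‖) (x := θ) (y := θ')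
    (fun z hz => hd z hz.1) (fun z hz => (hC θ hθ z hz.1).trans (by
      gcongr
      simpa [dist_eq_norm] using hz.2))
    ⟨hθ, by simp⟩ ⟨hθ', by simp [dist_eq_norm]⟩
  rwa [mul_assoc, ← sq] at h

/-- A zero of a map whose derivative is negative definite, quantitatively so at `θ₀`, is close to
`θ₀` when the value of the map at `θ₀` is small. -/
lemma min_norm_le_of_eq_zero {f : E → E} {C lam ρ : ℝ} (hlam : 0 < lam) (hρ : 0 < ρ)
    (hC0 : 0 ≤ C) (hCρ : C * ρ ≤ lam / 2) (hc : Convex ℝ Θ)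
    (hd : ∀ θ ∈ Θ, DifferentiableAt ℝ f θ)
    (hC : ∀ θ ∈ Θ, ∀ θ' ∈ Θ, ‖fderiv ℝ f θ' - fderiv ℝ f θ‖ ≤ C * ‖θ' - θ‖)
    (hneg : ∀ θ ∈ Θ, ∀ v, inner ℝ v (fderiv ℝ f θ v) ≤ 0) (hθ₀ : θ₀ ∈ Θ)
    (hneg₀ : ∀ v, inner ℝ v (fderiv ℝ f θ₀ v) ≤ -lam * ‖v‖ ^ 2) {θ : E} (hθ : θ ∈ Θ)
    (hf : f θ = 0) :
    min ‖θ - θ₀‖ ρ ≤ 2 / lam * ‖f θ₀‖ := by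
  set v := θ - θ₀ with hv
  rcases eq_or_ne v 0 with h0 | h0
  · rw [h0, norm_zero, min_eq_left hρ.le]
    positivity
  have hv0 : 0 < ‖v‖ := norm_pos_iff.2 h0
  have hseg : ∀ s ∈ Set.Icc (0 : ℝ) 1, θ₀ + s • v ∈ Θ := fun s hs => by
    have := hc.add_smul_sub_mem hθ₀ hθ hs
    simpa [hv] using this
  -- Everything takes place on the segment from `θ₀` to the zero `θ`, where `φ` decreases from `φ 0
  -- ≤ ‖v‖ ‖f θ₀‖` to `φ 1 = 0`.
  set φ : ℝ → ℝ := fun s => inner ℝ v (f (θ₀ + s • v)) with hφ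
  have hφd : ∀ s ∈ Set.Icc (0 : ℝ) 1,
      HasDerivAt φ (inner ℝ v (fderiv ℝ f (θ₀ + s • v) v)) s := fun s hs => by
    have h1 : HasDerivAt (fun s : ℝ => θ₀ + s • v) v s := by
      simpa using ((hasDerivAt_id s).smul_const v).const_add θ₀
    have h2 := (hd _ (hseg s hs)).hasFDerivAt.comp_hasDerivAt s h1
    exact (innerSL ℝ v).hasFDerivAt.comp_hasDerivAt s h2
  -- The time at which the segment leaves the ball of radius `ρ`, or `1` if it never does. Up to
  -- `s₀` the derivative keeps half of its coercivity at `θ₀`; after `s₀` monotonicity suffices.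
  set s₀ : ℝ := min 1 (ρ / ‖v‖) with hs₀
  have hs₀0 : 0 < s₀ := lt_min one_pos (by positivity)
  have hs₀1 : s₀ ≤ 1 := min_le_left _ _
  have hs₀v : s₀ * ‖v‖ = min ‖v‖ ρ := by
    rw [hs₀, min_mul_of_nonneg _ _ hv0.le, one_mul, div_mul_cancel₀ _ hv0.ne']
  have hstep1 : φ s₀ - φ 0 ≤ -(lam / 2 * ‖v‖ ^ 2) * (s₀ - 0) := by
    refine (convex_Icc 0 s₀).image_sub_le_mul_sub_of_deriv_le (f := φ)
      (fun s hs => (hφd s ⟨hs.1, hs.2.trans hs₀1⟩).continuousAt.continuousWithinAt)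
      (fun s hs => (hφd s ?_).differentiableAt.differentiableWithinAt) (fun s hs => ?_)
      0 ⟨le_rfl, hs₀0.le⟩ s₀ ⟨hs₀0.le, le_rfl⟩ hs₀0.le
    · have := interior_subset hs; exact ⟨this.1, this.2.trans hs₀1⟩
    · have hs' := interior_subset hs
      have hsI : s ∈ Set.Icc (0 : ℝ) 1 := ⟨hs'.1, hs'.2.trans hs₀1⟩
      rw [(hφd s hsI).deriv]
      have h1 := hC θ₀ hθ₀ _ (hseg s hsI)
      rw [add_sub_cancel_left, norm_smul, Real.norm_of_nonneg hs'.1] at h1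
      have h2 : s * ‖v‖ ≤ ρ :=
        (mul_le_mul_of_nonneg_right hs'.2 hv0.le).trans (hs₀v.le.trans (min_le_right _ _))
      have h3 : ‖fderiv ℝ f (θ₀ + s • v) - fderiv ℝ f θ₀‖ ≤ lam / 2 :=
        h1.trans ((mul_le_mul_of_nonneg_left h2 hC0).trans hCρ)
      have h4 : inner ℝ v ((fderiv ℝ f (θ₀ + s • v) - fderiv ℝ f θ₀) v) ≤
          ‖v‖ * (lam / 2 * ‖v‖) :=
        (real_inner_le_norm _ _).trans (mul_le_mul_of_nonneg_left
          ((fderiv ℝ f (θ₀ + s • v) - fderiv ℝ f θ₀).le_of_opNorm_le h3 v) hv0.le)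
      have h5 := hneg₀ v
      rw [_root_.sub_apply, inner_sub_right] at h4
      nlinarith
  have hstep2 : φ 1 - φ s₀ ≤ 0 * (1 - s₀) := by
    refine (convex_Icc s₀ 1).image_sub_le_mul_sub_of_deriv_le (f := φ)
      (fun s hs => (hφd s ⟨hs₀0.le.trans hs.1, hs.2⟩).continuousAt.continuousWithinAt)
      (fun s hs => (hφd s ?_).differentiableAt.differentiableWithinAt) (fun s hs => ?_)
      s₀ ⟨le_rfl, hs₀1⟩ 1 ⟨hs₀1, le_rfl⟩ hs₀1
    · have := interior_subset hs; exact ⟨hs₀0.le.trans this.1, this.2⟩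
    · have hs' := interior_subset hs
      have hsI : s ∈ Set.Icc (0 : ℝ) 1 := ⟨hs₀0.le.trans hs'.1, hs'.2⟩
      rw [(hφd s hsI).deriv]
      exact hneg _ (hseg s hsI) v
  have hφ1 : φ 1 = 0 := by simp [hφ, hv, hf]
  have hφ0 : φ 0 ≤ ‖v‖ * ‖f θ₀‖ := by
    simpa [hφ] using real_inner_le_norm v (f θ₀)
  have h6 : lam / 2 * ‖v‖ ^ 2 * s₀ ≤ ‖v‖ * ‖f θ₀‖ := by linarith
  have h7 : lam / 2 * (s₀ * ‖v‖) ≤ ‖f θ₀‖ := by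
    refine le_of_mul_le_mul_left ?_ hv0
    linarith
  rw [← hs₀v, div_mul_eq_mul_div, le_div_iff₀ hlam]
  linarith

/-- Asymptotic linearity of the zeros of a sequence of monotone estimating equations. -/
lemma tendsto_linearization_zero {f : ℕ → E → E} {C lam : ℝ} {L : E →L[ℝ] E} (hlam : 0 < lam)
    (hL : ∀ v, inner ℝ v (L v) ≤ -lam * ‖v‖ ^ 2) (hc : Convex ℝ Θ) (hθ₀ : θ₀ ∈ Θ) (hC0 : 0 ≤ C)
    (hd : ∀ᶠ i in atTop, ∀ θ ∈ Θ, DifferentiableAt ℝ (f i) θ)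
    (hC : ∀ᶠ i in atTop, ∀ θ ∈ Θ, ∀ θ' ∈ Θ,
      ‖fderiv ℝ (f i) θ' - fderiv ℝ (f i) θ‖ ≤ C * ‖θ' - θ‖)
    (hneg : ∀ᶠ i in atTop, ∀ θ ∈ Θ, ∀ v, inner ℝ v (fderiv ℝ (f i) θ v) ≤ 0)
    {θ : ℕ → E} (hθ : ∀ᶠ i in atTop, θ i ∈ Θ ∧ f i (θ i) = 0)
    {τ a κ : ℕ → ℝ} {S : ℕ → E} (hτ : Tendsto τ atTop atTop)
    (ha : ∀ᶠ i in atTop, ‖τ i • f i θ₀ - S i‖ ≤ a i) (ha0 : Tendsto a atTop (𝓝 0))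
    (hκ : ∀ᶠ i in atTop, ‖fderiv ℝ (f i) θ₀ - L‖ ≤ κ i) (hκ0 : Tendsto κ atTop (𝓝 0))
    (hκS : Tendsto (fun i => κ i * ‖S i‖) atTop (𝓝 0))
    (hS : Tendsto (fun i => (τ i)⁻¹ * ‖S i‖ ^ 2) atTop (𝓝 0)) :
    Tendsto (fun i => L (τ i • (θ i - θ₀)) + S i) atTop (𝓝 0) := by
  have hτi : Tendsto (fun i => (τ i)⁻¹) atTop (𝓝 0) := tendsto_inv_atTop_zero.comp hτ
  have hτ0 : ∀ᶠ i in atTop, 0 < τ i := hτ.eventually_gt_atTop 0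
  -- The derivative of `f i` at `θ₀` is eventually coercive with constant `lam / 2`, and `ρ` makes
  -- the Lipschitz variation at most half of that. The `+ 1` allows `C = 0`.
  set ρ : ℝ := lam / (4 * (C + 1)) with hρ
  have hρ0 : 0 < ρ := by positivity
  have hCρ : C * ρ ≤ lam / 2 / 2 := by
    rw [hρ, ← mul_div_assoc, div_le_div_iff₀ (by positivity) (by positivity)]
    nlinarith
  have hf0 : ∀ᶠ i in atTop, ‖f i θ₀‖ ≤ (τ i)⁻¹ * (‖S i‖ + a i) := by
    filter_upwards [ha, hτ0] with i hi hτi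
    rw [le_inv_mul_iff₀ hτi]
    have h1 : τ i * ‖f i θ₀‖ = ‖τ i • f i θ₀‖ := by
      rw [norm_smul, Real.norm_of_nonneg hτi.le]
    have h2 := norm_le_norm_add_norm_sub' (τ i • f i θ₀) (S i)
    linarith
  have hsmall : Tendsto (fun i => (τ i)⁻¹ * (‖S i‖ + a i)) atTop (𝓝 0) := by
    have hb : Tendsto (fun i => (τ i)⁻¹ + (τ i)⁻¹ * ‖S i‖ ^ 2 + (τ i)⁻¹ * a i) atTop (𝓝 0) := by
      simpa using (hτi.add hS).add (hτi.mul ha0)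
    refine squeeze_zero' ?_ ?_ hb
    · filter_upwards [ha, hτ0] with i hi hτi
      have := (norm_nonneg _).trans hi
      positivity
    · filter_upwards [hτ0] with i hτi
      have : (τ i)⁻¹ * ‖S i‖ ≤ (τ i)⁻¹ * (1 + ‖S i‖ ^ 2) := by
        gcongr
        nlinarith [sq_nonneg (‖S i‖ - 1)]
      linarith
  set K : ℝ := 2 / (lam / 2) with hK
  have hK0 : 0 < K := by positivity
  have hv : ∀ᶠ i in atTop, ‖θ i - θ₀‖ ≤ K * ((τ i)⁻¹ * (‖S i‖ + a i)) := by
    filter_upwards [hf0, hd, hC, hneg, hθ, hκ, hκ0.eventually_le_const (half_pos hlam),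
      (hsmall.const_mul K).eventually_lt_const (by simpa using hρ0)]
      with i h1 h2 h3 h4 h5 h6 h7 h8
    have hneg₀ : ∀ v, inner ℝ v (fderiv ℝ (f i) θ₀ v) ≤ -(lam / 2) * ‖v‖ ^ 2 := fun v => by
      have h9 : inner ℝ v ((fderiv ℝ (f i) θ₀ - L) v) ≤ ‖v‖ * (lam / 2 * ‖v‖) :=
        (real_inner_le_norm _ _).trans (mul_le_mul_of_nonneg_left
          ((fderiv ℝ (f i) θ₀ - L).le_of_opNorm_le (h6.trans h7) v) (norm_nonneg _))
      rw [_root_.sub_apply, inner_sub_right] at h9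
      nlinarith [hL v]
    have h10 := min_norm_le_of_eq_zero (half_pos hlam) hρ0 hC0 hCρ hc h2 h3 h4 hθ₀ hneg₀ h5.1 h5.2
    have h11 : min ‖θ i - θ₀‖ ρ ≤ K * ((τ i)⁻¹ * (‖S i‖ + a i)) :=
      h10.trans (mul_le_mul_of_nonneg_left h1 hK0.le)
    -- Consistency: the bound is eventually smaller than `ρ`, so the minimum must be `‖θ i - θ₀‖`.
    rcases min_le_iff.1 h11 with h12 | h12
    · exact h12
    · exact absurd h12 (not_le.2 h8)
  have hb : Tendsto (fun i => a i + C * (2 * K ^ 2 * ((τ i)⁻¹ * ‖S i‖ ^ 2 + (τ i)⁻¹ * a i ^ 2)) +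
      K * (κ i * ‖S i‖ + κ i * a i)) atTop (𝓝 0) := by
    have h1 := ((hS.add (hτi.mul (ha0.pow 2))).const_mul (2 * K ^ 2)).const_mul C
    have h2 := (hκS.add (hκ0.mul ha0)).const_mul K
    simpa using (ha0.add h1).add h2
  refine squeeze_zero_norm' ?_ hb
  filter_upwards [hv, hd, hC, hθ, hκ, ha, hτ0] with i h1 h2 h3 h4 h5 h6 h7
  have ha' := (norm_nonneg _).trans h6
  have hκ' := (norm_nonneg _).trans h5
  have h8 := norm_taylor_le hC0 hc h2 h3 hθ₀ h4.1
  rw [h4.2] at h8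
  have h9 : τ i * ‖θ i - θ₀‖ ≤ K * (‖S i‖ + a i) := by
    calc _ ≤ τ i * (K * ((τ i)⁻¹ * (‖S i‖ + a i))) := by gcongr
      _ = _ := by field_simp
  have h10 : τ i * ‖θ i - θ₀‖ ^ 2 ≤ 2 * K ^ 2 * ((τ i)⁻¹ * ‖S i‖ ^ 2 + (τ i)⁻¹ * a i ^ 2) := by
    calc τ i * ‖θ i - θ₀‖ ^ 2 = (τ i)⁻¹ * (τ i * ‖θ i - θ₀‖) ^ 2 := by field_simp
      _ ≤ (τ i)⁻¹ * (K * (‖S i‖ + a i)) ^ 2 := by gcongr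
      _ ≤ (τ i)⁻¹ * (K ^ 2 * (2 * (‖S i‖ ^ 2 + a i ^ 2))) := by
        rw [mul_pow]
        gcongr
        exact add_sq_le
      _ = _ := by ring
  -- Using `f i (θ i) = 0`, the error splits into the score approximation at `θ₀`, the scaled Taylor
  -- remainder and the error of the derivative.
  have h11 : L (τ i • (θ i - θ₀)) + S i =
      -(τ i • f i θ₀ - S i) - τ i • (0 - f i θ₀ - fderiv ℝ (f i) θ₀ (θ i - θ₀)) -
        (fderiv ℝ (f i) θ₀ - L) (τ i • (θ i - θ₀)) := by
    rw [_root_.sub_apply, ContinuousLinearMap.map_smul, ContinuousLinearMap.map_smul]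
    module
  have h12 : ‖(fderiv ℝ (f i) θ₀ - L) (τ i • (θ i - θ₀))‖ ≤ κ i * (K * (‖S i‖ + a i)) := by
    refine ((fderiv ℝ (f i) θ₀ - L).le_of_opNorm_le h5 _).trans ?_
    rw [norm_smul, Real.norm_of_nonneg h7.le]
    gcongr
  have h13 : ‖τ i • (0 - f i θ₀ - fderiv ℝ (f i) θ₀ (θ i - θ₀))‖ ≤
      C * (2 * K ^ 2 * ((τ i)⁻¹ * ‖S i‖ ^ 2 + (τ i)⁻¹ * a i ^ 2)) := by
    rw [norm_smul, Real.norm_of_nonneg h7.le]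
    calc _ ≤ τ i * (C * ‖θ i - θ₀‖ ^ 2) := by gcongr
      _ = C * (τ i * ‖θ i - θ₀‖ ^ 2) := by ring
      _ ≤ _ := by gcongr
  rw [h11]
  refine (norm_sub_le _ _).trans ((add_le_add ((norm_sub_le _ _).trans
    (add_le_add ((norm_neg _).trans_le h6) h13)) h12).trans (le_of_eq ?_))
  ring

end Deterministic

/-! ### Asymptotics of the weighted likelihood equations -/

section Asymptotics

variable {p d : ℕ} {m : Torus p → Param d → ℝ} {Θ : Set (Param d)} {θ₀ : Param d}
  {R : PearsonKind p d} {A : ℝ → ℝ} {c : ℝ}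

lemma inner_apply_eq_dotProduct_jacobian (F : Param d → Param d) (θ v : Param d) :
    inner ℝ v (fderiv ℝ F θ v) = (v : Fin d → ℝ) ⬝ᵥ (jacobian F θ *ᵥ v) := by
  conv_lhs => rw [clm_eq_sum_single (fderiv ℝ F θ)]
  simp [PiLp.inner_apply, dotProduct, mulVec, jacobian, mul_comm]

lemma inner_fderiv_nonpos {F : Param d → Param d} {θ : Param d} (h : IsNegDef (jacobian F θ))
    (v : Param d) : inner ℝ v (fderiv ℝ F θ v) ≤ 0 := by
  rw [inner_apply_eq_dotProduct_jacobian]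
  rcases eq_or_ne (v : Fin d → ℝ) 0 with h0 | h0
  · simp [h0]
  · exact (h _ h0).le

/-- Averages inherit the Lipschitz constant and the sign of the quadratic form. Semidefiniteness is
enough here, since coercivity at `θ₀` comes from the limit `L`. -/
lemma meanPsiN_regular (hΘ : IsOpen Θ) (hconv : Convex ℝ Θ) {ys : ℕ → Torus p} {n : ℕ} {C : ℝ}
    (hC0 : 0 ≤ C) (hdiff : ∀ y, DifferentiableOn ℝ (psiN R A m ys n y) Θ)
    (hdef : ∀ y, ∀ θ ∈ Θ, IsNegDef (jacobian (psiN R A m ys n y) θ))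
    (hdiff2 : ∀ y, DifferentiableOn ℝ (fderiv ℝ (psiN R A m ys n y)) Θ)
    (hC : ∀ y, ∀ θ ∈ Θ, ‖fderiv ℝ (fderiv ℝ (psiN R A m ys n y)) θ‖ ≤ C) :
    (∀ θ ∈ Θ, DifferentiableAt ℝ (meanPsiN R A m ys n) θ) ∧
    (∀ θ ∈ Θ, ∀ θ' ∈ Θ, ‖fderiv ℝ (meanPsiN R A m ys n) θ' -
      fderiv ℝ (meanPsiN R A m ys n) θ‖ ≤ C * ‖θ' - θ‖) ∧
    ∀ θ ∈ Θ, ∀ v, inner ℝ v (fderiv ℝ (meanPsiN R A m ys n) θ v) ≤ 0 := by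
  have hfd : ∀ θ ∈ Θ, HasFDerivAt (meanPsiN R A m ys n)
      ((n : ℝ)⁻¹ • ∑ i ∈ Finset.range n, fderiv ℝ (psiN R A m ys n (ys i)) θ) θ := fun θ hθ => by
    have h := HasFDerivAt.fun_sum (u := Finset.range n) fun i _ =>
      ((hdiff (ys i)).differentiableAt (hΘ.mem_nhds hθ)).hasFDerivAt
    exact h.const_smul (n : ℝ)⁻¹
  refine ⟨fun θ hθ => (hfd θ hθ).differentiableAt, fun θ hθ θ' hθ' => ?_, fun θ hθ v => ?_⟩
  · have hsub : fderiv ℝ (meanPsiN R A m ys n) θ' - fderiv ℝ (meanPsiN R A m ys n) θ =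
        (n : ℝ)⁻¹ • ∑ i ∈ Finset.range n,
          (fderiv ℝ (psiN R A m ys n (ys i)) θ' - fderiv ℝ (psiN R A m ys n (ys i)) θ) := by
      rw [(hfd θ hθ).fderiv, (hfd θ' hθ').fderiv, Finset.sum_sub_distrib]
      exact (smul_sub _ _ _).symm
    rw [hsub, norm_smul, norm_inv, Real.norm_natCast]
    calc _ ≤ (n : ℝ)⁻¹ * ∑ i ∈ Finset.range n, C * ‖θ' - θ‖ := by
          gcongr
          exact norm_sum_le_of_le _ fun i _ =>
            norm_fderiv_sub_le hΘ hconv (hdiff2 _) (hC _) θ hθ θ' hθ'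
      _ ≤ C * ‖θ' - θ‖ := by
          simp only [Finset.sum_const, Finset.card_range, nsmul_eq_mul]
          rcases n.eq_zero_or_pos with rfl | hn
          · simpa using by positivity
          · rw [inv_mul_cancel_left₀ (by positivity)]
  · rw [(hfd θ hθ).fderiv, _root_.smul_apply, inner_smul_right, _root_.sum_apply, inner_sum]
    exact mul_nonpos_of_nonneg_of_nonpos (by positivity)
      (Finset.sum_nonpos fun i _ => inner_fderiv_nonpos (hdef _ θ hθ) v)

lemma tendsto_inv_sqrt_natCast : Tendsto (fun n : ℕ => (Real.sqrt n)⁻¹) atTop (𝓝 0) :=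
  tendsto_inv_atTop_zero.comp (Real.tendsto_sqrt_atTop.comp tendsto_natCast_atTop_atTop)

lemma sqrt_mul_inv_self (n : ℕ) : Real.sqrt n * (n : ℝ)⁻¹ = (Real.sqrt n)⁻¹ := by
  rw [← div_eq_mul_inv, Real.sqrt_div_self', one_div]

section Random

variable {Ω : Type*} [MeasurableSpace Ω] {P : Measure Ω} [IsProbabilityMeasure P]
  {Y : ℕ → Ω → Torus p}

/-- The error of the score approximation at `θ₀`, and that of the derivative, are controlled by
null sequences. -/
lemma exists_null_bounds (hm : IsRegularModel m Θ θ₀) (hR : R.IsAdmissible Θ)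
    (hA : IsRAF A) (hc : 0 < c)
    (hlow : ∀ y, ∀ θ ∈ Θ, c ≤ m y θ ∧ c ≤ R.smoothed (fun t => m t θ) θ y)
    (hY : ∀ i, Measurable (Y i)) (hindep : iIndepFun Y P)
    (hlaw : ∀ i, P.map (Y i) = modelLaw m θ₀) :
    ∃ (t : ℕ → ℝ) (s : ℝ) (a ρ : ℕ → Ω → ℝ), 0 ≤ s ∧ (∀ n, 0 < t n) ∧
      (∀ n ≥ 1, t n ≤ s * (Real.sqrt n)⁻¹) ∧ TendstoZeroInMean P a ∧ TendstoZeroInMean P ρ ∧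
      (∀ (n : ℕ) (ω : Ω), ‖Real.sqrt n • meanPsiN R A m (fun i => Y i ω) n θ₀ -
        Real.sqrt n • meanScore m (fun i => Y i ω) n θ₀‖ ≤ a n ω) ∧
      ∀ (n : ℕ) (ω : Ω) (C : ℝ), 0 ≤ C →
        (∀ θ ∈ Θ, DifferentiableAt ℝ (meanPsiN R A m (fun i => Y i ω) n) θ) →
        (∀ θ ∈ Θ, ∀ θ' ∈ Θ, ‖fderiv ℝ (meanPsiN R A m (fun i => Y i ω) n) θ' -
          fderiv ℝ (meanPsiN R A m (fun i => Y i ω) n) θ‖ ≤ C * ‖θ' - θ‖) →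
        ‖fderiv ℝ (meanPsiN R A m (fun i => Y i ω) n) θ₀ -
          ∫ y, fderiv ℝ (score m y) θ₀ ∂(modelLaw m θ₀)‖ ≤ ρ n ω + d * (C * t n) := by
  have hpos : ∀ y, ∀ θ ∈ Θ, 0 < m y θ := fun y θ hθ => hc.trans_le (hlow y θ hθ).1
  obtain ⟨r₁, hr₁, K, hK, hrΘ, hrem⟩ := exists_norm_meanPsiN_sub_meanScore_le hm hR hA hc hlow
  obtain ⟨r₂, hr₂, hr₂Θ, -, g, hg, hg0, hgd, hgb⟩ := hm.exists_local_bounds hpos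
  obtain ⟨H, hH, hkde⟩ := exists_integral_kdeError_le hm hR hpos hY hindep hlaw
  have hLi := (hasFDerivAt_meanPsi hm hR hA hc hlow).1
  set s : ℝ := min r₁ r₂ / 2 with hs
  have hs0 : 0 < s := by positivity
  have hsr₁ : s < r₁ := by
    have := min_le_left r₁ r₂
    linarith
  have hsr₂ : s < r₂ := by
    have := min_le_right r₁ r₂
    linarith
  -- The step must tend to `0` more slowly than `1/n`, so that the kernel error divided by it still
  -- vanishes. The factor `s` keeps `θ₀ + t n • e k` in both balls, and the `+ 1` makes `t 0`
  -- positive.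
  set t : ℕ → ℝ := fun n => s * (Real.sqrt ((n : ℝ) + 1))⁻¹ with ht
  have ht0 : ∀ n, 0 < t n := fun n => by positivity
  have hts : ∀ n, t n ≤ s := fun n => by
    refine mul_le_of_le_one_right hs0.le (inv_le_one_of_one_le₀ ?_)
    rw [Real.one_le_sqrt]
    linarith [n.cast_nonneg (α := ℝ)]
  have htl : Tendsto t atTop (𝓝 0) := by
    have := (tendsto_inv_sqrt_natCast.comp (tendsto_add_atTop_nat 1)).const_mul s
    simpa [ht, Function.comp_def] using this
  let e : Fin d → Param d := fun k => EuclideanSpace.single k 1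
  have he : ∀ k, ‖e k‖ = 1 := fun k => by simp [e]
  have hdist : ∀ n k, ‖(θ₀ + t n • e k) - θ₀‖ = t n := fun n k => by
    rw [add_sub_cancel_left, norm_smul, he, mul_one, Real.norm_of_nonneg (ht0 n).le]
  have hmem₁ : ∀ n k, θ₀ + t n • e k ∈ Metric.ball θ₀ r₁ := fun n k => by
    rw [Metric.mem_ball, dist_eq_norm, hdist]; exact (hts n).trans_lt hsr₁
  have hmem₂ : ∀ n k, θ₀ + t n • e k ∈ Metric.ball θ₀ r₂ := fun n k => by
    rw [Metric.mem_ball, dist_eq_norm, hdist]; exact (hts n).trans_lt hsr₂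
  have hmem₀ : θ₀ ∈ Metric.ball θ₀ r₂ := Metric.mem_ball_self hr₂
  -- A bound for the mean norm of the score that holds on the whole ball, since the evaluation
  -- points move with `n`.
  set U : ℝ := ∫ y, (‖score m y θ₀‖ + g y * r₂) ∂(modelLaw m θ₀) with hU
  have hUi : Integrable (fun y => ‖score m y θ₀‖ + g y * r₂) (modelLaw m θ₀) :=
    (hm.integrable_score hpos).norm.add (hg.mul_const _)
  have hUb : ∀ θ ∈ Metric.ball θ₀ r₂, ∀ y, ‖score m y θ‖ ≤ ‖score m y θ₀‖ + g y * r₂ := by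
    intro θ hθ y
    have h1 := hgb y θ hθ
    have h2 : ‖θ - θ₀‖ ≤ r₂ := by
      rw [← dist_eq_norm]; exact (Metric.mem_ball.1 hθ).le
    have h3 := norm_le_norm_add_norm_sub' (score m y θ) (score m y θ₀)
    have h4 := mul_le_mul_of_nonneg_left h2 (hg0 y)
    linarith
  have hsi : ∀ θ ∈ Metric.ball θ₀ r₂, Integrable (fun y => ‖score m y θ‖) (modelLaw m θ₀) :=
    fun θ hθ => hUi.mono' (hm.measurable_score hpos (hr₂Θ hθ)).norm.aestronglyMeasurable
      (ae_of_all _ fun y => by rw [norm_norm]; exact hUb θ hθ y)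
  have hsU : ∀ θ ∈ Metric.ball θ₀ r₂, ∫ y, ‖score m y θ‖ ∂(modelLaw m θ₀) ≤ U :=
    fun θ hθ => integral_mono (hsi θ hθ) hUi (hUb θ hθ)
  have hkdeU : ∀ n, ∀ θ ∈ Metric.ball θ₀ r₂,
      ∫ ω, kdeError R m θ₀ (fun i => Y i ω) n θ ∂P ≤ (n : ℝ)⁻¹ * (H * U) := fun n θ hθ =>
    (hkde n θ (hr₂Θ hθ) (hsi θ hθ)).2.trans (by have := hsU θ hθ; gcongr)
  have hkdei : ∀ n, ∀ θ ∈ Metric.ball θ₀ r₂,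
      Integrable (fun ω => kdeError R m θ₀ (fun i => Y i ω) n θ) P := fun n θ hθ =>
    (hkde n θ (hr₂Θ hθ) (hsi θ hθ)).1
  have hrate : Tendsto (fun n : ℕ => (t n)⁻¹ * (n : ℝ)⁻¹) atTop (𝓝 0) := by
    have h1 : Tendsto (fun n : ℕ => s⁻¹ * (2 * (Real.sqrt n)⁻¹)) atTop (𝓝 0) := by
      simpa using (tendsto_inv_sqrt_natCast.const_mul 2).const_mul s⁻¹
    refine squeeze_zero (fun n => ?_) (fun n => ?_) h1
    · have := ht0 n
      positivity
    · rcases n.eq_zero_or_pos with rfl | hn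
      · simp
      · have hn1 : (1 : ℝ) ≤ n := by exact_mod_cast hn
        have h2 : Real.sqrt ((n : ℝ) + 1) ≤ 2 * Real.sqrt n := by
          rw [Real.sqrt_le_left (by positivity), mul_pow, Real.sq_sqrt (by positivity)]
          linarith
        simp only [ht, mul_inv, inv_inv]
        rw [mul_assoc]
        refine mul_le_mul_of_nonneg_left ?_ (by positivity)
        calc _ ≤ 2 * Real.sqrt n * (n : ℝ)⁻¹ := by gcongr
          _ = 2 * (Real.sqrt n)⁻¹ := by rw [mul_assoc, sqrt_mul_inv_self]
  have hkdeT : ∀ θ : ℕ → Param d, (∀ n, θ n ∈ Metric.ball θ₀ r₂) →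
      TendstoZeroInMean P fun n ω => K * ((t n)⁻¹ * kdeError R m θ₀ (fun i => Y i ω) n (θ n)) := by
    intro θ hθ
    refine .of_integral_le (b := fun n => K * ((t n)⁻¹ * (n : ℝ)⁻¹ * (H * U)))
      (fun n ω => ?_) (fun n => ((hkdei n _ (hθ n)).const_mul _).const_mul _) ?_ fun n => ?_
    · have := kdeError_nonneg (R := R) (m := m) (θ₀ := θ₀) (fun i => Y i ω) n (θ n)
      have := ht0 n
      positivity
    · simpa using (hrate.mul_const (H * U)).const_mul K
    · rw [integral_const_mul, integral_const_mul, mul_assoc]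
      have := ht0 n
      have := hkdeU n _ (hθ n)
      gcongr
  have hnormT : ∀ k, TendstoZeroInMean P fun n ω =>
      K * (t n * meanScoreNorm m (fun i => Y i ω) n (θ₀ + t n • e k)) := fun k => by
    refine .of_integral_le (b := fun n => K * (t n * U)) (fun n ω => ?_)
      (fun n => ((integrable_mean_comp hY hlaw (hsi _ (hmem₂ n k)) n).const_mul _).const_mul _)
      (by simpa using (htl.mul_const U).const_mul K) fun n => ?_
    · have := meanScoreNorm_nonneg (m := m) (fun i => Y i ω) n (θ₀ + t n • e k)
      have := ht0 n
      positivity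
    · rw [integral_const_mul, integral_const_mul]
      have h1 := (integral_mean_comp_le hY hlaw (hsi _ (hmem₂ n k))
        (integral_nonneg fun _ => norm_nonneg _) n).trans (hsU _ (hmem₂ n k))
      have := ht0 n
      have : ∫ ω, meanScoreNorm m (fun i => Y i ω) n (θ₀ + t n • e k) ∂P ≤ U := h1
      gcongr
  -- In each direction `ρ` collects the error of the score quotient, the kernel errors at both ends
  -- divided by the step, and the quadratic weight remainder. The constant `C` stays outside `ρ`
  -- because it will depend on `ω`.
  refine ⟨t, s, fun n ω => K * (Real.sqrt n * kdeError R m θ₀ (fun i => Y i ω) n θ₀), fun n ω =>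
    ∑ k, (‖(t n)⁻¹ • (meanScore m (fun i => Y i ω) n (θ₀ + t n • e k) -
          meanScore m (fun i => Y i ω) n θ₀) -
        ∫ y, fderiv ℝ (score m y) θ₀ (e k) ∂(modelLaw m θ₀)‖ +
      K * ((t n)⁻¹ * kdeError R m θ₀ (fun i => Y i ω) n (θ₀ + t n • e k)) +
      K * ((t n)⁻¹ * kdeError R m θ₀ (fun i => Y i ω) n θ₀) +
      K * (t n * meanScoreNorm m (fun i => Y i ω) n (θ₀ + t n • e k))),
    hs0.le, ht0, fun n hn => ?_, ?_, ?_, fun n ω => ?_, fun n ω C hC0 hd hC => ?_⟩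
  · have : (1 : ℝ) ≤ n := by exact_mod_cast hn
    simp only [ht]
    gcongr
    linarith
  · refine .of_integral_le (b := fun n : ℕ => K * ((Real.sqrt n)⁻¹ * (H * U))) (fun n ω => ?_)
      (fun n => ((hkdei n _ hmem₀).const_mul _).const_mul _)
      (by simpa using (tendsto_inv_sqrt_natCast.mul_const (H * U)).const_mul K) fun n => ?_
    · have := kdeError_nonneg (R := R) (m := m) (θ₀ := θ₀) (fun i => Y i ω) n θ₀
      positivity
    · rw [integral_const_mul, integral_const_mul, ← sqrt_mul_inv_self, mul_assoc]
      have := hkdeU n _ hmem₀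
      gcongr
  · exact TendstoZeroInMean.sum _ fun k =>
      (((tendstoZeroInMean_score_quotient hm hpos hY hindep hlaw hr₂Θ hg hgd hgb ht0 htl
        fun n => hmem₂ n k).add (hkdeT _ fun n => hmem₂ n k)).add
        (hkdeT (fun _ => θ₀) fun _ => hmem₀)).add (hnormT k)
  · have h1 := hrem (fun i => Y i ω) n θ₀ (Metric.mem_ball_self hr₁)
    simp only [sub_self, norm_zero, ne_eq, OfNat.ofNat_ne_zero, not_false_eq_true, zero_pow,
      zero_mul, add_zero] at h1
    rw [← smul_sub, norm_smul, Real.norm_of_nonneg (Real.sqrt_nonneg _)]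
    calc _ ≤ Real.sqrt n * (K * kdeError R m θ₀ (fun i => Y i ω) n θ₀) := by gcongr
      _ = _ := by ring
  · set F := meanPsiN R A m (fun i => Y i ω) n with hF
    set G := meanScore m (fun i => Y i ω) n with hG
    refine (norm_clm_le_sum_single _).trans ?_
    have hcard : (d : ℝ) * (C * t n) = ∑ _k : Fin d, C * t n := by simp
    rw [hcard, ← Finset.sum_add_distrib]
    refine Finset.sum_le_sum fun k _ => ?_
    have htn := ht0 n
    have h1 := norm_taylor_le hC0 hm.convex hd hC hm.true_mem (hrΘ (hmem₁ n k))
    rw [hdist, add_sub_cancel_left, ContinuousLinearMap.map_smul] at h1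
    have h2 := hrem (fun i => Y i ω) n _ (hmem₁ n k)
    rw [hdist] at h2
    have h3 := hrem (fun i => Y i ω) n θ₀ (Metric.mem_ball_self hr₁)
    simp only [sub_self, norm_zero, ne_eq, OfNat.ofNat_ne_zero, not_false_eq_true, zero_pow,
      zero_mul, add_zero] at h3
    -- The Jacobian is replaced by a difference quotient of `F`, then `F` by the mean score `G` at
    -- both ends, then the quotient of `G` by its limit.
    have h4 : (fderiv ℝ F θ₀ - ∫ y, fderiv ℝ (score m y) θ₀ ∂(modelLaw m θ₀)) (e k) =
        -((t n)⁻¹ • (F (θ₀ + t n • e k) - F θ₀ - t n • fderiv ℝ F θ₀ (e k))) +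
        ((t n)⁻¹ • (F (θ₀ + t n • e k) - G (θ₀ + t n • e k)) -
          (t n)⁻¹ • (F θ₀ - G θ₀)) +
        ((t n)⁻¹ • (G (θ₀ + t n • e k) - G θ₀) -
          ∫ y, fderiv ℝ (score m y) θ₀ (e k) ∂(modelLaw m θ₀)) := by
      rw [_root_.sub_apply, ContinuousLinearMap.integral_apply hLi, smul_sub _ _ (t n • _),
        inv_smul_smul₀ htn.ne']
      module
    change ‖(fderiv ℝ F θ₀ - ∫ y, fderiv ℝ (score m y) θ₀ ∂(modelLaw m θ₀)) (e k)‖ ≤ _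
    rw [h4]
    refine (norm_add_le _ _).trans ((add_le_add ((norm_add_le _ _).trans (add_le_add
      (norm_neg _).le (norm_sub_le _ _))) le_rfl).trans ?_)
    simp only [norm_smul, norm_inv, Real.norm_of_nonneg htn.le]
    have h5 : (t n)⁻¹ * ‖F (θ₀ + t n • e k) - F θ₀ - t n • fderiv ℝ F θ₀ (e k)‖ ≤ C * t n := by
      rw [inv_mul_le_iff₀ htn]
      linarith
    have h6 : (t n)⁻¹ * ‖F (θ₀ + t n • e k) - G (θ₀ + t n • e k)‖ ≤
        K * ((t n)⁻¹ * kdeError R m θ₀ (fun i => Y i ω) n (θ₀ + t n • e k)) +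
          K * (t n * meanScoreNorm m (fun i => Y i ω) n (θ₀ + t n • e k)) := by
      calc _ ≤ (t n)⁻¹ * (K * (kdeError R m θ₀ (fun i => Y i ω) n (θ₀ + t n • e k) +
            t n ^ 2 * meanScoreNorm m (fun i => Y i ω) n (θ₀ + t n • e k))) := by gcongr
        _ = _ := by field_simp
    have h7 : (t n)⁻¹ * ‖F θ₀ - G θ₀‖ ≤
        K * ((t n)⁻¹ * kdeError R m θ₀ (fun i => Y i ω) n θ₀) := by
      calc _ ≤ (t n)⁻¹ * (K * kdeError R m θ₀ (fun i => Y i ω) n θ₀) := by gcongr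
        _ = _ := by ring
    linarith

end Random

/-- A positive definite matrix is coercive. -/
lemma exists_le_dotProduct_mulVec {S : Matrix (Fin d) (Fin d) ℝ} (hS : S.PosDef) :
    ∃ lam > 0, ∀ v : Param d, lam * ‖v‖ ^ 2 ≤ (v : Fin d → ℝ) ⬝ᵥ (S *ᵥ v) := by
  set q : Param d → ℝ := fun v => (v : Fin d → ℝ) ⬝ᵥ (S *ᵥ v) with hq
  have hqc : Continuous q := by
    simp only [hq]
    fun_prop
  have hpos : ∀ v : Param d, v ≠ 0 → 0 < q v := fun v hv => by
    have := hS.dotProduct_mulVec_pos (x := (v : Fin d → ℝ))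
      (fun h => hv (by ext j; exact congrFun h j))
    simpa using this
  have hhom : ∀ (a : ℝ) (v : Param d), q (a • v) = a ^ 2 * q v := fun a v => by
    simp only [hq, WithLp.ofLp_smul, mulVec_smul, dotProduct_smul, smul_dotProduct, smul_eq_mul]
    ring
  rcases (Metric.sphere (0 : Param d) 1).eq_empty_or_nonempty with h | h
  -- An empty unit sphere forces the space to be trivial, that is `d = 0`.
  · refine ⟨1, one_pos, fun v => ?_⟩
    rcases eq_or_ne v 0 with rfl | hv
    · simp
    · have : ‖v‖⁻¹ • v ∈ Metric.sphere (0 : Param d) 1 := by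
        simp [norm_smul, norm_ne_zero_iff.2 hv]
      rw [h] at this
      exact this.elim
  · obtain ⟨w, hw, hmin⟩ := (isCompact_sphere (0 : Param d) 1).exists_isMinOn h hqc.continuousOn
    have hw1 : ‖w‖ = 1 := by simpa using hw
    refine ⟨q w, hpos w (by rintro rfl; simp at hw1), fun v => ?_⟩
    rcases eq_or_ne v 0 with rfl | hv
    · simp
    · have hv0 : ‖v‖ ≠ 0 := norm_ne_zero_iff.2 hv
      have h1 : q w ≤ q (‖v‖⁻¹ • v) := hmin (by simp [norm_smul, hv0])
      rw [hhom, inv_pow, le_inv_mul_iff₀ (by positivity)] at h1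
      rw [mul_comm]
      exact h1

end Asymptotics

/-! ### The limit law of the standardized score -/

section Limit

variable {p d : ℕ} {m : Torus p → Param d → ℝ} {Θ : Set (Param d)} {θ₀ : Param d}
  {R : PearsonKind p d} {A : ℝ → ℝ} {c : ℝ}

/-- The mean derivative of the score is minus the second moment matrix, as an operator. -/
lemma integral_fderiv_score_eq_neg (hm : IsRegularModel m Θ θ₀) (hR : R.IsAdmissible Θ)
    (hA : IsRAF A) (hc : 0 < c)
    (hlow : ∀ y, ∀ θ ∈ Θ, c ≤ m y θ ∧ c ≤ R.smoothed (fun t => m t θ) θ y) (v : Param d) :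
    (∫ y, fderiv ℝ (score m y) θ₀ ∂(modelLaw m θ₀)) v =
      -Matrix.toEuclideanCLM (𝕜 := ℝ) (psiSecondMoment R A m θ₀) v := by
  conv_lhs => rw [clm_eq_sum_single (∫ y, fderiv ℝ (score m y) θ₀ ∂(modelLaw m θ₀))]
  ext j
  simp [integral_fderiv_score_apply hm hR hA hc hlow, mulVec, dotProduct, mul_comm]

variable {Ω : Type*} [MeasurableSpace Ω] {P : Measure Ω} [IsProbabilityMeasure P]
  {Y : ℕ → Ω → Torus p}

/-- Asymptotic normality of the standardized score. -/
lemma tendstoInDistribution_standardized_score (hm : IsRegularModel m Θ θ₀)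
    (hpos : ∀ y, ∀ θ ∈ Θ, 0 < m y θ) (hY : ∀ i, Measurable (Y i)) (hindep : iIndepFun Y P)
    (hlaw : ∀ i, P.map (Y i) = modelLaw m θ₀) {S : Matrix (Fin d) (Fin d) ℝ} (hS : S.PosDef)
    (hSu : ∀ j k, S j k = ∫ y, score m y θ₀ j * score m y θ₀ k ∂(modelLaw m θ₀)) :
    TendstoInDistribution (fun (n : ℕ) ω => (Real.sqrt n)⁻¹ • ∑ i ∈ Finset.range n,
        Matrix.toEuclideanCLM (𝕜 := ℝ) S⁻¹ (score m (Y i ω) θ₀))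
      atTop id (fun _ => P) (multivariateGaussian 0 S⁻¹) := by
  set T := Matrix.toEuclideanCLM (𝕜 := ℝ) S⁻¹ with hT
  have hu := hm.measurable_score hpos hm.true_mem
  have hTu : Measurable fun y => T (score m y θ₀) := T.continuous.measurable.comp hu
  have hident : ∀ i, IdentDistrib (Y i) (Y 0) P P := fun i =>
    ⟨(hY i).aemeasurable, (hY 0).aemeasurable, by rw [hlaw i, hlaw 0]⟩
  have hL2 : MemLp (fun y => T (score m y θ₀)) 2 (modelLaw m θ₀) :=
    T.comp_memLp' (hm.memLp_score hpos)
  have hc : ∀ j, MemLp (fun y => score m y θ₀ j) 2 (modelLaw m θ₀) := hm.memLp_score_apply hpos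
  refine tendstoInDistribution_inv_sqrt_smul_sum (hindep.comp _ fun _ => hTu)
    (fun i => (hident i).comp hTu) ((hlaw 0 ▸ hL2).comp_of_map (hY 0).aemeasurable) ?_
    hS.inv.posSemidef fun j k => ?_
  · have h := T.integral_comp_comm (hm.integrable_score hpos)
    rw [hm.integral_score_eq_zero hpos, map_zero, ← hlaw 0, integral_map (hY 0).aemeasurable
      hTu.aestronglyMeasurable] at h
    exact h
  · have h1 : ∫ ω, T (score m (Y 0 ω) θ₀) j * T (score m (Y 0 ω) θ₀) k ∂P =
        ∫ y, T (score m y θ₀) j * T (score m y θ₀) k ∂(modelLaw m θ₀) := by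
      rw [← hlaw 0, integral_map (hY 0).aemeasurable]
      exact Measurable.aestronglyMeasurable (by fun_prop)
    have h2 : ∀ y, T (score m y θ₀) j * T (score m y θ₀) k =
        ∑ a, ∑ b, S⁻¹ j a * S⁻¹ k b * (score m y θ₀ a * score m y θ₀ b) := fun y => by
      simp only [hT, Matrix.ofLp_toEuclideanCLM, mulVec, dotProduct, Finset.sum_mul_sum]
      refine Finset.sum_congr rfl fun a _ => Finset.sum_congr rfl fun b _ => ?_
      ring
    have h3 : ∀ a b, Integrable (fun y => S⁻¹ j a * S⁻¹ k b * (score m y θ₀ a * score m y θ₀ b))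
        (modelLaw m θ₀) := fun a b => ((hc a).integrable_mul (hc b)).const_mul _
    -- The sandwich covariance of `S⁻¹ u` collapses because `S` is the covariance of `u`.
    have h4 : S⁻¹ * S * (S⁻¹)ᵀ = S⁻¹ := by
      rw [Matrix.nonsing_inv_mul _ ((Matrix.isUnit_iff_isUnit_det _).1 hS.isUnit), one_mul]
      simpa using hS.inv.isHermitian.eq
    change ∫ ω, T (score m (Y 0 ω) θ₀) j * T (score m (Y 0 ω) θ₀) k ∂P = _
    rw [h1, ← congrFun (congrFun h4 j) k]
    simp only [h2]
    rw [integral_finsetSum _ fun a _ => integrable_finsetSum _ fun b _ => h3 a b]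
    simp only [fun a => integral_finsetSum Finset.univ fun b _ => h3 a b, integral_const_mul,
      ← hSu, Matrix.mul_apply, Matrix.transpose_apply, Finset.sum_mul]
    rw [Finset.sum_comm]
    refine Finset.sum_congr rfl fun a _ => Finset.sum_congr rfl fun b _ => ?_
    ring

end Limit

end
end TorusWLE

/-! ### Asymptotic normality: linearization along subsequences -/

open TorusWLE
theorem mainTheorem2 {Ω : Type*} [MeasurableSpace Ω] (P : Measure Ω) [IsProbabilityMeasure P]
    {p d : ℕ} (Θ : Set (Param d)) (θ₀ : Param d) (m : Torus p → Param d → ℝ)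
    (A : ℝ → ℝ) (R : PearsonKind p d)
    (Y : ℕ → Ω → Torus p) (θhat : ℕ → Ω → Param d)
    -- the regularity conditions for maximum likelihood
    (hm : IsRegularModel m Θ θ₀)
    -- the observations are i.i.d. with density `m(·; θ₀)`
    (hY : ∀ i, Measurable (Y i)) (hindep : iIndepFun Y P)
    (hlaw : ∀ i, P.map (Y i) = modelLaw m θ₀)
    -- the kernel and the residual adjustment function
    (hR : R.IsAdmissible Θ) (hA : IsRAF A)
    -- the model densities and the smoothed model densities are bounded away from zero
    (hpos : ∃ c > 0, ∀ y, ∀ θ ∈ Θ, c ≤ m y θ ∧ c ≤ R.smoothed (fun t => m t θ) θ y)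
    -- the conditions on `Ψ`
    (hΨ_diff : ∀ y, DifferentiableOn ℝ (psi R A m θ₀ y) Θ)
    (hΨ_def : ∀ y, ∀ θ ∈ Θ, IsNegDef (jacobian (psi R A m θ₀ y) θ))
    (hΨ_int : ∀ θ ∈ Θ, ∀ j k,
      Integrable (fun y => jacobian (psi R A m θ₀ y) θ j k) (modelLaw m θ₀))
    -- the conditions on `Ψₙ`
    (hΨn_diff : ∀ᵐ ω ∂P, ∀ n ≥ 1, ∀ y,
      DifferentiableOn ℝ (psiN R A m (fun i => Y i ω) n y) Θ)
    (hΨn_def : ∀ᵐ ω ∂P, ∀ n ≥ 1, ∀ y, ∀ θ ∈ Θ,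
      IsNegDef (jacobian (psiN R A m (fun i => Y i ω) n y) θ))
    (hΨn_diff2 : ∀ᵐ ω ∂P, ∀ n ≥ 1, ∀ y,
      DifferentiableOn ℝ (fderiv ℝ (psiN R A m (fun i => Y i ω) n y)) Θ)
    (hΨn_bdd2 : ∀ᵐ ω ∂P, ∃ C : ℝ, ∀ n ≥ 1, ∀ y, ∀ θ ∈ Θ,
      ‖fderiv ℝ (fderiv ℝ (psiN R A m (fun i => Y i ω) n y)) θ‖ ≤ C)
    (hΨn_env : ∃ K : Torus p → ℝ, Integrable K (modelLaw m θ₀) ∧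
      ∀ᵐ ω ∂P, ∀ n ≥ 1, ∀ y, ∀ θ ∈ Θ, ∀ j k,
        |jacobian (psiN R A m (fun i => Y i ω) n y) θ j k| ≤ K y)
    -- the estimators solve the weighted likelihood equations
    (hθ_meas : ∀ n, AEMeasurable (θhat n) P)
    (hθ_sol : ∀ᵐ ω ∂P, ∀ᶠ n in atTop, θhat n ω ∈ Θ ∧
      ∑ i ∈ Finset.range n, psiN R A m (fun i => Y i ω) n (Y i ω) (θhat n ω) = 0) :
    -- the second moment matrix of `Ψ(Y; θ₀)` is positive definite
    (psiSecondMoment R A m θ₀).PosDef ∧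
    -- it equals `B` (Bartlett), where `B` is minus the Jacobian of `ε` at `θ₀`
    (DifferentiableAt ℝ (meanPsi R A m θ₀) θ₀ ∧
      psiSecondMoment R A m θ₀ = -jacobian (meanPsi R A m θ₀) θ₀) ∧
    -- asymptotic normality
    TendstoInDistribution (fun (n : ℕ) ω => Real.sqrt n • (θhat n ω - θ₀)) atTop id (fun _ => P)
      (multivariateGaussian 0 (psiSecondMoment R A m θ₀)⁻¹) := by
  obtain ⟨c, hc, hlow⟩ := hpos
  have hpos : ∀ y, ∀ θ ∈ Θ, 0 < m y θ := fun y θ hθ => hc.trans_le (hlow y θ hθ).1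
  have hs : ∀ y, 0 < R.smoothed (fun t => m t θ₀) θ₀ y :=
    fun y => hc.trans_le (hlow y _ hm.true_mem).2
  have hPD := posDef_psiSecondMoment hm hR hA hc hlow fun y => hΨ_def y _ hm.true_mem
  refine ⟨hPD, ⟨(hasFDerivAt_meanPsi hm hR hA hc hlow).2.differentiableAt,
    psiSecondMoment_eq_neg_jacobian hm hR hA hc hlow⟩, ?_⟩
  set S := psiSecondMoment R A m θ₀ with hS
  have hclt := tendstoInDistribution_standardized_score hm hpos hY hindep hlaw hPD
    (psiSecondMoment_apply hA hs)
  have hmeasY : ∀ n : ℕ, AEMeasurable (fun ω => Real.sqrt n • (θhat n ω - θ₀)) P := fun n =>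
    ((hθ_meas n).sub_const _).const_smul (Real.sqrt n)
  -- Slutsky: it remains to show that the estimation error and the standardized score differ by a
  -- term tending to zero in probability.
  refine tendstoInDistribution_of_tendstoInMeasure_sub _ _ hclt ?_ hmeasY
  obtain ⟨t, s, a, ρ, hs0, ht0, hts, ha, hρ, haF, hρF⟩ :=
    exists_null_bounds hm hR hA hc hlow hY hindep hlaw
  set L : Param d →L[ℝ] Param d := ∫ y, fderiv ℝ (score m y) θ₀ ∂(modelLaw m θ₀) with hLdef
  have hLS : ∀ v, L v = -Matrix.toEuclideanCLM (𝕜 := ℝ) S v :=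
    integral_fderiv_score_eq_neg hm hR hA hc hlow
  set T := Matrix.toEuclideanCLM (𝕜 := ℝ) S⁻¹ with hT
  have hTL : ∀ v, T (L v) = -v := fun v => by
    have h1 : T * Matrix.toEuclideanCLM (𝕜 := ℝ) S = 1 := by
      rw [hT, ← map_mul, Matrix.nonsing_inv_mul _ ((Matrix.isUnit_iff_isUnit_det _).1 hPD.isUnit),
        map_one]
    rw [hLS, map_neg, neg_inj]
    exact DFunLike.congr_fun h1 v
  obtain ⟨lam, hlam, hcoer⟩ := exists_le_dotProduct_mulVec hPD
  have hLneg : ∀ v, inner ℝ v (L v) ≤ -lam * ‖v‖ ^ 2 := fun v => by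
    have h1 : inner ℝ v (Matrix.toEuclideanCLM (𝕜 := ℝ) S v) =
        (v : Fin d → ℝ) ⬝ᵥ (S *ᵥ (v : Fin d → ℝ)) := by
      simp [PiLp.inner_apply, dotProduct, mul_comm]
    rw [hLS, inner_neg_right, h1]
    linarith [hcoer v]
  set W : ℕ → Ω → Param d := fun n ω =>
    (Real.sqrt n)⁻¹ • ∑ i ∈ Finset.range n, score m (Y i ω) θ₀ with hW
  have hWS : ∀ n ω, W n ω = Real.sqrt n • meanScore m (fun i => Y i ω) n θ₀ := fun n ω => by
    rw [meanScore, smul_smul, sqrt_mul_inv_self]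
  have hu := hm.measurable_score hpos hm.true_mem
  have hident : ∀ i, IdentDistrib (Y i) (Y 0) P P := fun i =>
    ⟨(hY i).aemeasurable, (hY 0).aemeasurable, by rw [hlaw i, hlaw 0]⟩
  have hu0 : ∫ ω, score m (Y 0 ω) θ₀ ∂P = 0 := by
    rw [← hm.integral_score_eq_zero hpos, ← hlaw 0, integral_map (hY 0).aemeasurable
      hu.aestronglyMeasurable]
  have hW2 := integral_norm_sq_inv_sqrt_smul_sum_le (P := P) (X := fun i ω => score m (Y i ω) θ₀)
    (hindep.comp _ fun _ => hu) (fun i => (hident i).comp hu)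
    ((hlaw 0 ▸ hm.memLp_score hpos).comp_of_map (hY 0).aemeasurable) hu0
  set V : ℝ := ∫ ω, ‖score m (Y 0 ω) θ₀‖ ^ 2 ∂P with hV
  have hWm : ∀ n, Measurable (W n) := fun n =>
    (Finset.measurable_fun_sum _ fun i _ => hu.comp (hY i)).const_smul (Real.sqrt n)⁻¹
  have hW1i : ∀ n, Integrable (fun ω => 1 + ‖W n ω‖ ^ 2) P := fun n =>
    (integrable_const 1).add (hW2 n).1
  have hWle : ∀ n ω, ‖W n ω‖ ≤ 1 + ‖W n ω‖ ^ 2 := fun n ω => by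
    nlinarith [sq_nonneg (‖W n ω‖ - 1)]
  have hWi : ∀ n, Integrable (fun ω => ‖W n ω‖) P := fun n =>
    (hW1i n).mono' (hWm n).norm.aestronglyMeasurable
      (ae_of_all _ fun ω => by rw [norm_norm]; exact hWle n ω)
  have hWb : ∀ n, ∫ ω, ‖W n ω‖ ∂P ≤ 1 + V := fun n => by
    refine (integral_mono (hWi n) (hW1i n) (hWle n)).trans ?_
    rw [integral_add (integrable_const 1) (hW2 n).1]
    have := (hW2 n).2
    simpa using this
  -- The product `ρ ‖W‖` has no obvious bound in mean; it is written as the product of `η⁻¹ ρ` and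
  -- `η ‖W‖`, both null in mean.
  obtain ⟨η, hη0, hη1, hη2⟩ := hρ.exists_rate (fun n ω => norm_nonneg (W n ω)) hWi hWb
  have hWsq : TendstoZeroInMean P fun n ω => (Real.sqrt n)⁻¹ * ‖W n ω‖ ^ 2 :=
    .of_integral_le (b := fun n : ℕ => (Real.sqrt n)⁻¹ * V) (fun n ω => by positivity)
      (fun n => (hW2 n).1.const_mul _) (by simpa using tendsto_inv_sqrt_natCast.mul_const V)
      fun n => by
        rw [integral_const_mul]
        exact mul_le_mul_of_nonneg_left (hW2 n).2 (by positivity)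
  -- All terms are nonnegative, so one subsequence along which the sum vanishes serves all five.
  have htot := (((ha.add hρ).add hη1).add hη2).add hWsq
  refine (exists_seq_tendstoInMeasure_atTop_iff fun n =>
    ((hmeasY n).sub (hclt.forall_aemeasurable n)).aestronglyMeasurable).2 fun ns hns => ?_
  obtain ⟨ns', hns', hae⟩ := htot.exists_subseq_ae hns
  refine ⟨ns', hns', ?_⟩
  have hN : Tendsto (fun i => ns (ns' i)) atTop atTop := (hns.comp hns').tendsto_atTop
  filter_upwards [hae, hΨn_diff, hΨn_def, hΨn_diff2, hΨn_bdd2, hθ_sol]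
    with ω htotω hdiff hdef hdiff2 hbdd hsol
  -- The constant depends on `ω`; this is harmless, as `ω` is now fixed.
  obtain ⟨C, hC⟩ := hbdd
  have hC0 : 0 ≤ |C| := abs_nonneg C
  have hN1 : ∀ᶠ i in atTop, 1 ≤ ns (ns' i) := hN.eventually_ge_atTop 1
  have hreg : ∀ n ≥ 1, _ := fun n hn => meanPsiN_regular hm.isOpen hm.convex hC0 (hdiff n hn)
    (hdef n hn) (hdiff2 n hn) fun y θ hθ => (hC n hn y θ hθ).trans (le_abs_self C)
  have hsq : ∀ {f : ℕ → ℝ}, (∀ i, 0 ≤ f i) → (∀ i, f i ≤ a (ns (ns' i)) ω + ρ (ns (ns' i)) ω +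
      (η (ns (ns' i)))⁻¹ * ρ (ns (ns' i)) ω + η (ns (ns' i)) * ‖W (ns (ns' i)) ω‖ +
      (Real.sqrt (ns (ns' i)))⁻¹ * ‖W (ns (ns' i)) ω‖ ^ 2) → Tendsto f atTop (𝓝 0) :=
    fun h1 h2 => squeeze_zero h1 h2 htotω
  have ha' := fun i => ha.nonneg (ns (ns' i)) ω
  have hρ' := fun i => hρ.nonneg (ns (ns' i)) ω
  have hη1' := fun i => hη1.nonneg (ns (ns' i)) ω
  have hη2' := fun i => hη2.nonneg (ns (ns' i)) ω
  have hWsq' := fun i => hWsq.nonneg (ns (ns' i)) ω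
  have la : Tendsto (fun i => a (ns (ns' i)) ω) atTop (𝓝 0) := hsq ha' fun i => by
    linarith [hρ' i, hη1' i, hη2' i, hWsq' i]
  have lρ : Tendsto (fun i => ρ (ns (ns' i)) ω) atTop (𝓝 0) := hsq hρ' fun i => by
    linarith [ha' i, hη1' i, hη2' i, hWsq' i]
  have lη1 : Tendsto (fun i => (η (ns (ns' i)))⁻¹ * ρ (ns (ns' i)) ω) atTop (𝓝 0) :=
    hsq hη1' fun i => by linarith [ha' i, hρ' i, hη2' i, hWsq' i]
  have lη2 : Tendsto (fun i => η (ns (ns' i)) * ‖W (ns (ns' i)) ω‖) atTop (𝓝 0) :=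
    hsq hη2' fun i => by linarith [ha' i, hρ' i, hη1' i, hWsq' i]
  have lW : Tendsto (fun i => (Real.sqrt (ns (ns' i)))⁻¹ * ‖W (ns (ns' i)) ω‖ ^ 2) atTop (𝓝 0) :=
    hsq hWsq' fun i => by linarith [ha' i, hρ' i, hη1' i, hη2' i]
  have lρW : Tendsto (fun i => ρ (ns (ns' i)) ω * ‖W (ns (ns' i)) ω‖) atTop (𝓝 0) := by
    have := lη1.mul lη2
    rw [mul_zero] at this
    refine this.congr fun i => ?_
    have := (hη0 (ns (ns' i))).ne'
    field_simp
  have lsqrt : Tendsto (fun i => (Real.sqrt (ns (ns' i)))⁻¹) atTop (𝓝 0) :=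
    tendsto_inv_sqrt_natCast.comp hN
  have lt : Tendsto (fun i => t (ns (ns' i))) atTop (𝓝 0) := by
    refine squeeze_zero' (Eventually.of_forall fun i => (ht0 _).le) ?_
      (by simpa using lsqrt.const_mul s)
    filter_upwards [hN1] with i hi using hts _ hi
  have ltW : Tendsto (fun i => t (ns (ns' i)) * ‖W (ns (ns' i)) ω‖) atTop (𝓝 0) := by
    have hb := (lsqrt.add lW).const_mul s
    rw [add_zero, mul_zero] at hb
    refine squeeze_zero' (Eventually.of_forall fun i =>
      mul_nonneg (ht0 _).le (norm_nonneg _)) ?_ hb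
    filter_upwards [hN1] with i hi
    calc _ ≤ s * (Real.sqrt (ns (ns' i)))⁻¹ * (1 + ‖W (ns (ns' i)) ω‖ ^ 2) := by
          have h1 := hts _ hi
          have h2 := hWle (ns (ns' i)) ω
          gcongr
      _ = _ := by ring
  have hlin := tendsto_linearization_zero (Θ := Θ) (θ₀ := θ₀) (C := |C|) (L := L)
    (f := fun i => meanPsiN R A m (fun j => Y j ω) (ns (ns' i)))
    (θ := fun i => θhat (ns (ns' i)) ω) (τ := fun i => Real.sqrt (ns (ns' i)))
    (a := fun i => a (ns (ns' i)) ω)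
    (κ := fun i => ρ (ns (ns' i)) ω + d * (|C| * t (ns (ns' i))))
    (S := fun i => W (ns (ns' i)) ω) hlam hLneg hm.convex hm.true_mem hC0
    (by filter_upwards [hN1] with i hi using (hreg _ hi).1)
    (by filter_upwards [hN1] with i hi using (hreg _ hi).2.1)
    (by filter_upwards [hN1] with i hi using (hreg _ hi).2.2)
    (by
      filter_upwards [hN.eventually hsol] with i hi
      exact ⟨hi.1, by rw [meanPsiN, hi.2, smul_zero]⟩)
    (Real.tendsto_sqrt_atTop.comp (tendsto_natCast_atTop_atTop.comp hN))
    (Eventually.of_forall fun i => by rw [hWS]; exact haF _ _) la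
    (by
      filter_upwards [hN1] with i hi
      exact hρF _ ω |C| hC0 (hreg _ hi).1 (hreg _ hi).2.1)
    (by simpa using lρ.add ((lt.const_mul |C|).const_mul (d : ℝ)))
    (by
      have := lρW.add ((ltW.const_mul |C|).const_mul (d : ℝ))
      simp only [mul_zero, add_zero] at this
      refine this.congr fun i => ?_
      ring)
    lW
  -- Since `T ∘ L = -1`, applying `-T` to `L x + W` gives `x - T W`, the difference to be
  -- controlled.
  have hfin := ((T.continuous.tendsto 0).comp hlin).neg
  rw [map_zero, neg_zero] at hfin
  refine hfin.congr fun i => ?_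
  simp only [Function.comp_apply, map_add, hTL, Pi.sub_apply, hW, map_smul, map_sum]
  module
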